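/- **Setting.** Let $\mathcal H$ be a real Hilbert space, let $n\ge 1$ and $m\ge 1$ be integers, and let $0\le\sigma_i<\beta_i\le+\infty$ for $i=1,\dots,m$. For $0\le\sigma<\beta\le+\infty$ let $\mathcal F_{\sigma,\beta}$ be the class of functions $f:\mathcal H\to\mathbb R\cup\{+\infty\}$ that are proper, such that $f-\frac{\sigma}{2}\|\cdot\|^2$ is convex, and that are differentiable with $\beta$-Lipschitz gradient if $\beta<+\infty$, and lower semicontinuous if $\beta=+\infty$. Let $\boldsymbol{\mathcal F}$ be the class of $\mathbf f=(f_1,\dots,f_m)$ with $f_i\in\mathcal F_{\sigma_i,\beta_i}$, acting by $\mathbf f(\mathbf y)=(f_i(y^{(i)}))_i$, and put $\boldsymbol\partial\mathbf f(\mathbf y)=\prod_i\partial f_i(y^{(i)})$, where $\partial f(x)=\{u:\ f(y)\ge f(x)+\langle u,y-x\rangle\ \forall y\in\mathcal H\}$. For a real matrix $M$ and a tuple $\mathbf z$ of vectors of $\mathcal H$, let $M\mathbf z$ be the tuple with components $\sum_j M_{ij}z^{(j)}$, and for symmetric $M$ let $\mathcal Q(M,\mathbf z)=\langle \mathbf z,M\mathbf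 z\rangle=\sum_{i,j}M_{ij}\langle z^{(i)},z^{(j)}\rangle$. Let $A\in\mathbb R^{n\times n}$, $B\in\mathbb R^{n\times m}$, $C\in\mathbb R^{m\times n}$, $D\in\mathbb R^{m\times m}$. Let $\mathcal S=\mathcal H^n\times\mathcal H^m\times\mathcal H^m\times\mathbb R^m$, with points $\boldsymbol\xi=(\mathbf x,\mathbf u,\mathbf y,\mathbf F)$. The point $\boldsymbol\xi$ is *algorithm-consistent* for $\mathbf f$ if $\mathbf y=C\mathbf x+D\mathbf u$, $\mathbf u\in\boldsymbol\partial\mathbf f(\mathbf y)$ and $\mathbf F=\mathbf f(\mathbf y)$. A *successor* of $\boldsymbol\xi$ (for $\mathbf f$) is an algorithm-consistent point $\boldsymbol\xi_+=(\mathbf x_+,\mathbf u_+,\mathbf y_+,\mathbf F_+)$ for $\mathbf f$ with $\mathbf x_+=A\mathbf x+B\mathbf u$. A *fixed point* (for $\mathbf f$) is an algorithm-consistent point $\boldsymbol\xi_\star=(\mathbf x_\star,\mathbf u_\star,\mathbf y_\star,\mathbf F_\star)$ for $\mathbf f$ with $\mathbf x_\star=A\mathbf x_\star+B\mathbf u_\star$.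 Let $N=\begin{bmatrix}I\\-\mathbf 1^\top\end{bmatrix}\in\mathbb R^{m\times(m-1)}$; if $m=1$, all block columns containing $N$ and all block rows containing $N^\top$ are removed. Assume: * (*fixed-point encoding*) $\operatorname{ran}\begin{bmatrix}BN&0\\DN&-\mathbf 1\end{bmatrix}\subseteq\operatorname{ran}\begin{bmatrix}I-A\\-C\end{bmatrix}$ and $\operatorname{null}\begin{bmatrix}I-A&-B\end{bmatrix}\subseteq\operatorname{null}\begin{bmatrix}N^\top C&N^\top D\\0&\mathbf 1^\top\end{bmatrix}$; * (*well-posedness*) $D$ is lower triangular with nonpositive diagonal elements, and for every $i$, $\beta_i<+\infty$ or $D_{ii}<0$. For symmetric $Q\in\mathbb R^{(n+2m)\times(n+2m)}$ and $q\in\mathbb R^m$ write $$W_{Q,q}(\boldsymbol\xi,\boldsymbol\xi_\star)=\mathcal Q\big(Q,(\mathbf x-\mathbf x_\star,\mathbf u,\mathbf u_\star)\big)+q^\top(\mathbf F-\mathbf F_\star).$$ Functions $V,R:\mathcal S\times\mathcal S\to\mathbb R$ are called *quadratic* if $V=W_{Q,q}$ and $R=W_{S,s}$ for some symmetric $Q,S$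 and some $q,s\in\mathbb R^m$. Let $\rho\in[0,1]$, let $P,T\in\mathbb R^{(n+2m)\times(n+2m)}$ be symmetric and $p,t\in\mathbb R^m$. Then $V$ and $R$ *satisfy the $(P,p,T,t,\rho)$-quadratic Lyapunov inequality* over $\boldsymbol{\mathcal F}$ if, for each $\mathbf f\in\boldsymbol{\mathcal F}$, each algorithm-consistent $\boldsymbol\xi$, each successor $\boldsymbol\xi_+$ of $\boldsymbol\xi$ and each fixed point $\boldsymbol\xi_\star$ for $\mathbf f$ (no successor being involved in C2 and C3): * C1. $V(\boldsymbol\xi_+,\boldsymbol\xi_\star)\le\rho V(\boldsymbol\xi,\boldsymbol\xi_\star)-R(\boldsymbol\xi,\boldsymbol\xi_\star)$; * C2. $V(\boldsymbol\xi,\boldsymbol\xi_\star)\ge W_{P,p}(\boldsymbol\xi,\boldsymbol\xi_\star)\ge0$; * C3. $R(\boldsymbol\xi,\boldsymbol\xi_\star)\ge W_{T,t}(\boldsymbol\xi,\boldsymbol\xi_\star)\ge0$. **Matrices of the semidefinite program.** For distinct $i,j\in\{ø,+,\star\}$ define $E_{i,j}\in\mathbb R^{3m\times(n+3m-1)}$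 and $H_{i,j}\in\mathbb R^{m\times 2m}$ by $$E_{ø,+}=\begin{bmatrix}C(I-A)&D-CB&-D&CBN\\0&I&0&0\\0&0&I&0\end{bmatrix},\quad E_{+,ø}=\begin{bmatrix}C(A-I)&CB-D&D&-CBN\\0&0&I&0\\0&I&0&0\end{bmatrix},$$ $$E_{ø,\star}=\begin{bmatrix}C&D&0&-DN\\0&I&0&0\\0&0&0&N\end{bmatrix},\quad E_{\star,ø}=\begin{bmatrix}-C&-D&0&DN\\0&0&0&N\\0&I&0&0\end{bmatrix},$$ $$E_{+,\star}=\begin{bmatrix}CA&CB&D&-DN-CBN\\0&0&I&0\\0&0&0&N\end{bmatrix},\quad E_{\star,+}=\begin{bmatrix}-CA&-CB&-D&DN+CBN\\0&0&0&N\\0&0&I&0\end{bmatrix},$$ $$H_{ø,+}=-H_{+,ø}=\begin{bmatrix}I&-I\end{bmatrix},\quad H_{ø,\star}=-H_{\star,ø}=\begin{bmatrix}I&0\end{bmatrix},\quad H_{+,\star}=-H_{\star,+}=\begin{bmatrix}0&I\end{bmatrix}.$$ With $e_1,\dots,e_m$ the standard basis of $\mathbb R^m$ and $\otimes$ the Kronecker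 product, let, for $l=1,\dots,m$, $$\mathbf M_l=\frac1{2(\beta_l-\sigma_l)}\begin{bmatrix}\beta_l\sigma_l&-\sigma_l&\beta_l\\-\sigma_l&1&-1\\\beta_l&-1&1\end{bmatrix}\otimes\operatorname{diag}(e_l)\ \text{ if }\beta_l<\infty,\qquad \mathbf M_l=\frac12\begin{bmatrix}\sigma_l&0&1\\0&0&0\\1&0&0\end{bmatrix}\otimes\operatorname{diag}(e_l)\ \text{ if }\beta_l=+\infty,$$ and $\mathbf M_{(l,i,j)}=E_{i,j}^\top\mathbf M_lE_{i,j}$, $\mathbf a_{(l,i,j)}=-H_{i,j}^\top e_l$. Finally, let $$\Sigma_ø=\begin{bmatrix}I&0&0&0\\0&I&0&0\\0&0&0&N\end{bmatrix},\qquad \Sigma_+=\begin{bmatrix}A&B&0&-BN\\0&0&I&0\\0&0&0&N\end{bmatrix}\qquad\text{in }\mathbb R^{(n+2m)\times(n+3m-1)}.$$ **Theorem.** Suppose in addition that $W_{P,p}(\boldsymbol\xi,\boldsymbol\xi_\star)\ge0$ and $W_{T,t}(\boldsymbol\xi,\boldsymbol\xi_\star)\ge0$ for each $\mathbf f\in\boldsymbol{\mathcal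 F}$, each $\boldsymbol\xi\in\mathcal S$ that is algorithm-consistent for $\mathbf f$ and each fixed point $\boldsymbol\xi_\star\in\mathcal S$ for $\mathbf f$. Consider the following system in the symmetric matrices $Q,S\in\mathbb R^{(n+2m)\times(n+2m)}$, the vectors $q,s\in\mathbb R^m$ and scalars $\lambda^{C1}_{(l,i,j)}\ge0$ (for $1\le l\le m$ and distinct $i,j\in\{ø,+,\star\}$) and $\lambda^{C2}_{(l,i,j)},\lambda^{C3}_{(l,i,j)}\ge0$ (for $1\le l\le m$ and distinct $i,j\in\{ø,\star\}$), where each sum is over all indices of the multipliers in it: $$\Sigma_ø^\top(\rho Q-S)\Sigma_ø-\Sigma_+^\top Q\Sigma_++\sum\lambda^{C1}_{(l,i,j)}\mathbf M_{(l,i,j)}\succeq0,\qquad\begin{bmatrix}\rho q-s\\-q\end{bmatrix}+\sum\lambda^{C1}_{(l,i,j)}\mathbf a_{(l,i,j)}=0,$$ $$\Sigma_ø^\top(Q-P)\Sigma_ø+\sum\lambda^{C2}_{(l,i,j)}\mathbf M_{(l,i,j)}\succeq0,\qquad\begin{bmatrix}q-p\\0\end{bmatrix}+\sum\lambda^{C2}_{(l,i,j)}\mathbf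 a_{(l,i,j)}=0,$$ $$\Sigma_ø^\top(S-T)\Sigma_ø+\sum\lambda^{C3}_{(l,i,j)}\mathbf M_{(l,i,j)}\succeq0,\qquad\begin{bmatrix}s-t\\0\end{bmatrix}+\sum\lambda^{C3}_{(l,i,j)}\mathbf a_{(l,i,j)}=0.$$ 1. If this system is feasible, then there exist quadratic functions $V,R:\mathcal S\times\mathcal S\to\mathbb R$ that satisfy the $(P,p,T,t,\rho)$-quadratic Lyapunov inequality over $\boldsymbol{\mathcal F}$. 2. Suppose moreover that $\dim\mathcal H\ge n+3m-1$ and that there exist a symmetric positive definite $G\in\mathbb R^{(n+3m-1)\times(n+3m-1)}$ and $\boldsymbol\chi\in\mathbb R^{2m}$ with $\mathbf a_{(l,i,j)}^\top\boldsymbol\chi+\operatorname{trace}(\mathbf M_{(l,i,j)}G)\le0$ for all $1\le l\le m$ and distinct $i,j\in\{ø,+,\star\}$. If there exist quadratic functions $V,R$ that satisfy the $(P,p,T,t,\rho)$-quadratic Lyapunov inequality over $\boldsymbol{\mathcal F}$, then the system is feasible. -/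

import Mathlib

open scoped ENNReal NNReal

namespace LyapunovAnalysis

noncomputable section

/-! ### Convex function classes -/

section Functions

/-- Convexity of an extended-real-valued function. -/
def ConvexFun {H : Type*} [AddCommGroup H] [Module ℝ H] (f : H → EReal) : Prop :=
  ∀ x y : H, ∀ r : ℝ, 0 ≤ r → r ≤ 1 →
    f ((1 - r) • x + r • y) ≤ ((1 - r : ℝ) : EReal) * f x + (r : EReal) * f y

/-- `f` is proper: its effective domain is nonempty. -/
def ProperFun {H : Type*} (f : H → EReal) : Prop := ∃ x, f x < ⊤

/-- `f` is proper and `f - (σ / 2) ‖·‖ ^ 2` is convex. -/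
def StronglyConvexFun {H : Type*} [NormedAddCommGroup H] [InnerProductSpace ℝ H]
    (σ : ℝ≥0) (f : H → EReal) : Prop :=
  ProperFun f ∧ ConvexFun fun x => f x - (((σ : ℝ) / 2 * ‖x‖ ^ 2 : ℝ) : EReal)

/-- `f` is (real-valued and) differentiable with `β`-Lipschitz gradient. -/
def SmoothFun {H : Type*} [NormedAddCommGroup H] [InnerProductSpace ℝ H] [CompleteSpace H]
    (β : ℝ≥0) (f : H → EReal) : Prop :=
  ∃ g : H → ℝ, (∀ x, f x = (g x : EReal)) ∧ Differentiable ℝ g ∧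
    ∀ x y, ‖gradient g x - gradient g y‖ ≤ (β : ℝ) * ‖x - y‖

/-- The class of functions `H → ℝ ∪ {+∞}` that are `σ`-strongly convex and moreover
`β`-smooth if `β < ∞`, lower semicontinuous if `β = ∞`. -/
def FunClass {H : Type*} [NormedAddCommGroup H] [InnerProductSpace ℝ H] [CompleteSpace H]
    (σ : ℝ≥0) (β : ℝ≥0∞) : Set (H → EReal) :=
  {f | (∀ x, f x ≠ ⊥) ∧ StronglyConvexFun σ f ∧
    (β ≠ ⊤ → SmoothFun β.toNNReal f) ∧ (β = ⊤ → LowerSemicontinuous f)}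

/-- The subdifferential of `f` at `x`. -/
def subdiff {H : Type*} [NormedAddCommGroup H] [InnerProductSpace ℝ H]
    (f : H → EReal) (x : H) : Set H :=
  {u | ∀ y, f x + ((inner ℝ u (y - x) : ℝ) : EReal) ≤ f y}

/-- `f = (f₁, …, f_m)` with `f_i` in the class with parameters `σ_i, β_i`. -/
def ProductClass {H : Type*} [NormedAddCommGroup H] [InnerProductSpace ℝ H] [CompleteSpace H]
    {m : ℕ} (σ : Fin m → ℝ≥0) (β : Fin m → ℝ≥0∞) : Set (Fin m → H → EReal) :=
  {f | ∀ i, f i ∈ FunClass (σ i) (β i)}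

end Functions

/-! ### Matrices acting on tuples of vectors -/

section Tuples

/-- The mapping `M ⊗ Id` on tuples of vectors. -/
def kronId {H : Type*} [AddCommGroup H] [Module ℝ H] {ι κ : Type*} [Fintype κ]
    (M : Matrix ι κ ℝ) (z : κ → H) : ι → H :=
  fun i => ∑ j, M i j • z j

/-- The quadratic form `⟨z, (M ⊗ Id) z⟩`. -/
def quadForm {H : Type*} [NormedAddCommGroup H] [InnerProductSpace ℝ H] {ι : Type*} [Fintype ι]
    (M : Matrix ι ι ℝ) (z : ι → H) : ℝ :=
  ∑ i, inner ℝ (z i) (kronId M z i)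

end Tuples

/-! ### Algorithms -/

section Algorithms

/-- The matrices of an algorithm in state-space form. -/
structure StateSpace (n m : ℕ) where
  A : Matrix (Fin n) (Fin n) ℝ
  B : Matrix (Fin n) (Fin m) ℝ
  C : Matrix (Fin m) (Fin n) ℝ
  D : Matrix (Fin m) (Fin m) ℝ

/-- The space `H^n × H^m × H^m × ℝ^m` of algorithm variables `(x, u, y, F)`. -/
structure Point (H : Type*) (n m : ℕ) where
  x : Fin n → H
  u : Fin m → H
  y : Fin m → H
  F : Fin m → ℝ

/-- Algorithm-consistent points for `f`. -/
structure IsConsistent {H : Type*} [NormedAddCommGroup H] [InnerProductSpace ℝ H]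
    {n m : ℕ} (K : StateSpace n m) (f : Fin m → H → EReal) (ξ : Point H n m) : Prop where
  output : ξ.y = kronId K.C ξ.x + kronId K.D ξ.u
  subgradient : ∀ i, ξ.u i ∈ subdiff (f i) (ξ.y i)
  value : ∀ i, (ξ.F i : EReal) = f i (ξ.y i)

/-- `η` is a successor of `ξ` for `f`. -/
structure IsSuccessor {H : Type*} [NormedAddCommGroup H] [InnerProductSpace ℝ H]
    {n m : ℕ} (K : StateSpace n m) (f : Fin m → H → EReal) (ξ η : Point H n m) : Prop where
  state : η.x = kronId K.A ξ.x + kronId K.B ξ.u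
  consistent : IsConsistent K f η

/-- The fixed-point equations for `f`. -/
structure IsFixedPoint {H : Type*} [NormedAddCommGroup H] [InnerProductSpace ℝ H]
    {n m : ℕ} (K : StateSpace n m) (f : Fin m → H → EReal) (ξ : Point H n m) : Prop where
  state : ξ.x = kronId K.A ξ.x + kronId K.B ξ.u
  consistent : IsConsistent K f ξ

/-- The `m × (m - 1)` matrix with the identity on top of a row with all entries `-1`
(a matrix without columns if `m = 1`). -/
def matN (m : ℕ) : Matrix (Fin m) (Fin (m - 1)) ℝ :=
  Matrix.of fun i j => if i.val = j.val then 1 else if i.val = m - 1 then -1 else 0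

/-- The range and null space conditions on the algorithm matrices which encode that fixed points
correspond to solutions. The blocks that contain `matN m` are empty if `m = 1`. -/
structure FixedPointEncoding {n m : ℕ} (K : StateSpace n m) : Prop where
  range_le :
    LinearMap.range (Matrix.fromBlocks (K.B * matN m) (0 : Matrix (Fin n) Unit ℝ)
        (K.D * matN m) (-Matrix.of fun _ _ => 1)).mulVecLin ≤
      LinearMap.range (Matrix.fromRows (1 - K.A) (-K.C)).mulVecLin
  null_le :
    LinearMap.ker (Matrix.fromCols (1 - K.A) (-K.B)).mulVecLin ≤
      LinearMap.ker (Matrix.fromBlocks ((matN m).transpose * K.C) ((matN m).transpose * K.D)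
        (0 : Matrix Unit (Fin n) ℝ) (Matrix.of fun _ _ => 1)).mulVecLin

/-- The well-posedness assumption. -/
structure WellPosed {n m : ℕ} (K : StateSpace n m) (β : Fin m → ℝ≥0∞) : Prop where
  cover : {i | β i < ⊤} ∪ {i | K.D i i < 0} = Set.univ
  lower_triangular : ∀ i j, i < j → K.D i j = 0
  diag_nonpos : ∀ i, K.D i i ≤ 0

end Algorithms

/-! ### Quadratic Lyapunov inequalities -/

section Lyapunov

/-- Index set of the coordinates of `(x - x⋆, u, u⋆)`. -/
abbrev StateIdx (n m : ℕ) : Type := Fin n ⊕ Fin m ⊕ Fin m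

/-- The function `(ξ, ξ⋆) ↦ 𝒬(Q, (x - x⋆, u, u⋆)) + qᵀ (F - F⋆)`. -/
def quadAnsatz {H : Type*} [NormedAddCommGroup H] [InnerProductSpace ℝ H] {n m : ℕ}
    (Q : Matrix (StateIdx n m) (StateIdx n m) ℝ) (q : Fin m → ℝ) (ξ ξs : Point H n m) : ℝ :=
  quadForm Q (Sum.elim (ξ.x - ξs.x) (Sum.elim ξ.u ξs.u)) + q ⬝ᵥ (ξ.F - ξs.F)

/-- `V` is a quadratic function of the form `quadAnsatz Q q` with `Q` symmetric. -/
def IsQuadratic {H : Type*} [NormedAddCommGroup H] [InnerProductSpace ℝ H] {n m : ℕ}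
    (V : Point H n m → Point H n m → ℝ) : Prop :=
  ∃ (Q : Matrix (StateIdx n m) (StateIdx n m) ℝ) (q : Fin m → ℝ),
    Q.IsSymm ∧ ∀ ξ ξs, V ξ ξs = quadAnsatz Q q ξ ξs

/-- The lower bound with parameters `(P, p)` is nonnegative at all pairs of an
algorithm-consistent point and a fixed point, over the whole function class. -/
def NonnegLowerBound (H : Type*) [NormedAddCommGroup H] [InnerProductSpace ℝ H] [CompleteSpace H]
    {n m : ℕ} (K : StateSpace n m) (σ : Fin m → ℝ≥0) (β : Fin m → ℝ≥0∞)
    (P : Matrix (StateIdx n m) (StateIdx n m) ℝ) (p : Fin m → ℝ) : Prop :=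
  ∀ f ∈ ProductClass (H := H) σ β, ∀ ξ ξs : Point H n m,
    IsConsistent K f ξ → IsFixedPoint K f ξs → 0 ≤ quadAnsatz P p ξ ξs

/-- `V` and `R` satisfy the `(P, p, T, t, ρ)`-quadratic Lyapunov inequality for the algorithm `K`
over the function class with parameters `σ, β`. -/
structure QuadraticLyapunovInequality {H : Type*} [NormedAddCommGroup H] [InnerProductSpace ℝ H]
    [CompleteSpace H] {n m : ℕ} (K : StateSpace n m) (σ : Fin m → ℝ≥0) (β : Fin m → ℝ≥0∞)
    (P : Matrix (StateIdx n m) (StateIdx n m) ℝ) (p : Fin m → ℝ)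
    (T : Matrix (StateIdx n m) (StateIdx n m) ℝ) (t : Fin m → ℝ) (ρ : ℝ)
    (V R : Point H n m → Point H n m → ℝ) : Prop where
  C1 : ∀ f ∈ ProductClass (H := H) σ β, ∀ ξ ξp ξs : Point H n m,
    IsConsistent K f ξ → IsSuccessor K f ξ ξp → IsFixedPoint K f ξs →
      V ξp ξs ≤ ρ * V ξ ξs - R ξ ξs
  C2 : ∀ f ∈ ProductClass (H := H) σ β, ∀ ξ ξs : Point H n m,
    IsConsistent K f ξ → IsFixedPoint K f ξs →
      quadAnsatz P p ξ ξs ≤ V ξ ξs ∧ 0 ≤ quadAnsatz P p ξ ξs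
  C3 : ∀ f ∈ ProductClass (H := H) σ β, ∀ ξ ξs : Point H n m,
    IsConsistent K f ξ → IsFixedPoint K f ξs →
      quadAnsatz T t ξ ξs ≤ R ξ ξs ∧ 0 ≤ quadAnsatz T t ξ ξs

end Lyapunov

/-! ### The semidefinite program -/

section SDP

/-- Labels of the three points: the current one, its successor and the fixed point. -/
inductive Label where
  | cur
  | next
  | star
  deriving DecidableEq

/-- Index set, of cardinality `n + 3m - 1`, of the coordinates of `(x - x⋆, u, u₊, û⋆)`,
where `û⋆` consists of the first `m - 1` components of `u⋆`. -/
abbrev LiftIdx (n m : ℕ) : Type := Fin n ⊕ Fin m ⊕ Fin m ⊕ Fin (m - 1)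

/-- A row of four blocks. -/
def row4 {ι κ₁ κ₂ κ₃ κ₄ : Type*} (X₁ : Matrix ι κ₁ ℝ) (X₂ : Matrix ι κ₂ ℝ) (X₃ : Matrix ι κ₃ ℝ)
    (X₄ : Matrix ι κ₄ ℝ) : Matrix ι (κ₁ ⊕ κ₂ ⊕ κ₃ ⊕ κ₄) ℝ :=
  Matrix.fromCols X₁ (Matrix.fromCols X₂ (Matrix.fromCols X₃ X₄))

/-- A row of three blocks. -/
def row3 {ι κ₁ κ₂ κ₃ : Type*} (X₁ : Matrix ι κ₁ ℝ) (X₂ : Matrix ι κ₂ ℝ) (X₃ : Matrix ι κ₃ ℝ) :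
    Matrix ι (κ₁ ⊕ κ₂ ⊕ κ₃) ℝ :=
  Matrix.fromCols X₁ (Matrix.fromCols X₂ X₃)

/-- A column of three blocks. -/
def col3 {ι₁ ι₂ ι₃ κ : Type*} (X₁ : Matrix ι₁ κ ℝ) (X₂ : Matrix ι₂ κ ℝ) (X₃ : Matrix ι₃ κ ℝ) :
    Matrix (ι₁ ⊕ ι₂ ⊕ ι₃) κ ℝ :=
  Matrix.fromRows X₁ (Matrix.fromRows X₂ X₃)

/-- The matrices `E_{i,j}` for distinct labels `i, j` (the value `0` for `i = j` is not used). -/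
def matE {n m : ℕ} (K : StateSpace n m) :
    Label → Label → Matrix (Fin m ⊕ Fin m ⊕ Fin m) (LiftIdx n m) ℝ
  | .cur, .next => col3
      (row4 (K.C * (1 - K.A)) (K.D - K.C * K.B) (-K.D) (K.C * K.B * matN m))
      (row4 0 1 0 0)
      (row4 0 0 1 0)
  | .cur, .star => col3
      (row4 K.C K.D 0 (-(K.D * matN m)))
      (row4 0 1 0 0)
      (row4 0 0 0 (matN m))
  | .next, .cur => col3
      (row4 (K.C * (K.A - 1)) (K.C * K.B - K.D) K.D (-(K.C * K.B * matN m)))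
      (row4 0 0 1 0)
      (row4 0 1 0 0)
  | .star, .cur => col3
      (row4 (-K.C) (-K.D) 0 (K.D * matN m))
      (row4 0 0 0 (matN m))
      (row4 0 1 0 0)
  | .next, .star => col3
      (row4 (K.C * K.A) (K.C * K.B) K.D (-(K.D * matN m) - K.C * K.B * matN m))
      (row4 0 0 1 0)
      (row4 0 0 0 (matN m))
  | .star, .next => col3
      (row4 (-(K.C * K.A)) (-(K.C * K.B)) (-K.D) (K.D * matN m + K.C * K.B * matN m))
      (row4 0 0 0 (matN m))
      (row4 0 0 1 0)
  | .cur, .cur => 0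
  | .next, .next => 0
  | .star, .star => 0

/-- The matrices `H_{i,j}` for distinct labels `i, j` (the value `0` for `i = j` is not used). -/
def matH (m : ℕ) : Label → Label → Matrix (Fin m) (Fin m ⊕ Fin m) ℝ
  | .cur, .next => Matrix.fromCols 1 (-1)
  | .next, .cur => Matrix.fromCols (-1) 1
  | .cur, .star => Matrix.fromCols 1 0
  | .star, .cur => Matrix.fromCols (-1) 0
  | .next, .star => Matrix.fromCols 0 1
  | .star, .next => Matrix.fromCols 0 (-1)
  | .cur, .cur => 0
  | .next, .next => 0
  | .star, .star => 0

/-- The matrix `diag(e_l)`. -/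
def diagUnit {m : ℕ} (l : Fin m) : Matrix (Fin m) (Fin m) ℝ :=
  Matrix.diagonal (Pi.single l 1)

open scoped Classical in
/-- The interpolation matrix `M_l`: the Kronecker product with `diag(e_l)` of a `3 × 3` matrix
that depends on `σ_l` and `β_l`. -/
def interpM {m : ℕ} (σ : Fin m → ℝ≥0) (β : Fin m → ℝ≥0∞) (l : Fin m) :
    Matrix (Fin m ⊕ Fin m ⊕ Fin m) (Fin m ⊕ Fin m ⊕ Fin m) ℝ :=
  if β l = ⊤ then
    (1 / 2 : ℝ) • col3
      (row3 ((σ l : ℝ) • diagUnit l) 0 (diagUnit l))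
      (row3 0 0 0)
      (row3 (diagUnit l) 0 0)
  else
    (1 / (2 * ((β l).toReal - (σ l : ℝ)))) • col3
      (row3 (((β l).toReal * (σ l : ℝ)) • diagUnit l) (-(σ l : ℝ) • diagUnit l)
        ((β l).toReal • diagUnit l))
      (row3 (-(σ l : ℝ) • diagUnit l) (diagUnit l) (-diagUnit l))
      (row3 ((β l).toReal • diagUnit l) (-diagUnit l) (diagUnit l))

/-- The vector `a_l = -e_l`. -/
def interpA {m : ℕ} (l : Fin m) : Fin m → ℝ := -Pi.single l 1

/-- The matrix `M_{(l,i,j)} = E_{i,j}ᵀ M_l E_{i,j}`. -/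
def liftM {n m : ℕ} (K : StateSpace n m) (σ : Fin m → ℝ≥0) (β : Fin m → ℝ≥0∞)
    (l : Fin m) (i j : Label) : Matrix (LiftIdx n m) (LiftIdx n m) ℝ :=
  (matE K i j).transpose * interpM σ β l * matE K i j

/-- The vector `a_{(l,i,j)} = H_{i,j}ᵀ a_l`. -/
def liftA {m : ℕ} (l : Fin m) (i j : Label) : Fin m ⊕ Fin m → ℝ :=
  (matH m i j).transpose.mulVec (interpA l)

/-- The matrix `Σ_ø`. -/
def sigmaCur (n m : ℕ) : Matrix (StateIdx n m) (LiftIdx n m) ℝ :=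
  col3 (row4 1 0 0 0) (row4 0 1 0 0) (row4 0 0 0 (matN m))

/-- The matrix `Σ_+`. -/
def sigmaNext {n m : ℕ} (K : StateSpace n m) : Matrix (StateIdx n m) (LiftIdx n m) ℝ :=
  col3 (row4 K.A K.B 0 (-(K.B * matN m))) (row4 0 0 1 0) (row4 0 0 0 (matN m))

/-- With multipliers `lam` for the pairs of distinct labels in `I`: the multipliers are nonnegative,
`W + ∑ λ_{(l,i,j)} M_{(l,i,j)}` is positive semidefinite and
`w + ∑ λ_{(l,i,j)} a_{(l,i,j)} = 0`. -/
structure Certificate {n m : ℕ} (K : StateSpace n m) (σ : Fin m → ℝ≥0) (β : Fin m → ℝ≥0∞)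
    (I : Finset Label) (W : Matrix (LiftIdx n m) (LiftIdx n m) ℝ) (w : Fin m ⊕ Fin m → ℝ)
    (lam : Fin m → Label → Label → ℝ) : Prop where
  nonneg : ∀ l, ∀ i ∈ I, ∀ j ∈ I, i ≠ j → 0 ≤ lam l i j
  posSemidef :
    (W + ∑ l, ∑ ij ∈ I.offDiag, lam l ij.1 ij.2 • liftM K σ β l ij.1 ij.2).PosSemidef
  eq_zero : w + ∑ l, ∑ ij ∈ I.offDiag, lam l ij.1 ij.2 • liftA l ij.1 ij.2 = 0

/-- Feasibility of the semidefinite program in `(Q, q, S, s)` and the multipliers. -/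
def SDPFeasible {n m : ℕ} (K : StateSpace n m) (σ : Fin m → ℝ≥0) (β : Fin m → ℝ≥0∞)
    (P : Matrix (StateIdx n m) (StateIdx n m) ℝ) (p : Fin m → ℝ)
    (T : Matrix (StateIdx n m) (StateIdx n m) ℝ) (t : Fin m → ℝ) (ρ : ℝ) : Prop :=
  ∃ (Q S : Matrix (StateIdx n m) (StateIdx n m) ℝ) (q s : Fin m → ℝ)
    (lam₁ lam₂ lam₃ : Fin m → Label → Label → ℝ),
    Q.IsSymm ∧ S.IsSymm ∧
    Certificate K σ β {.cur, .next, .star}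
      ((sigmaCur n m).transpose * (ρ • Q - S) * sigmaCur n m
        - (sigmaNext K).transpose * Q * sigmaNext K)
      (Sum.elim (ρ • q - s) (-q)) lam₁ ∧
    Certificate K σ β {.cur, .star}
      ((sigmaCur n m).transpose * (Q - P) * sigmaCur n m)
      (Sum.elim (q - p) 0) lam₂ ∧
    Certificate K σ β {.cur, .star}
      ((sigmaCur n m).transpose * (S - T) * sigmaCur n m)
      (Sum.elim (s - t) 0) lam₃

/-- The Slater-type condition: a positive definite `G` and a vector `χ` that satisfy all the
inequalities `a_{(l,i,j)}ᵀ χ + trace (M_{(l,i,j)} G) ≤ 0`. -/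
def SlaterPoint {n m : ℕ} (K : StateSpace n m) (σ : Fin m → ℝ≥0) (β : Fin m → ℝ≥0∞) : Prop :=
  ∃ (G : Matrix (LiftIdx n m) (LiftIdx n m) ℝ) (χ : Fin m ⊕ Fin m → ℝ), G.PosDef ∧
    ∀ (l : Fin m) (i j : Label), i ≠ j →
      liftA l i j ⬝ᵥ χ + (liftM K σ β l i j * G).trace ≤ 0

end SDP

end

end LyapunovAnalysis

open LyapunovAnalysis

/-!
The proof is semidefinite duality, with interpolation as the bridge between functions and matrices.

*Lifted coordinates.* A current point, a successor and a fixed point are described by the tuple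
`z = (x - x⋆, u, u₊, v)`, where `u⋆ = N v`, together with the differences of function values. The
null space condition yields `∑ i, u⋆ i = 0`, so that `v` exists; the range condition yields a fixed
point for every prescribed `v`. In these coordinates the Lyapunov functions become quadratic forms
in `z`, and the constraint with the index `(l, i, j)` becomes the interpolation inequality between
the points `i` and `j` for the function `f l` (`IsLift.constraint_le_zero_iff`).

*Interpolation.* The inequality holds for all functions of the class (`interpGap_le`). Conversely,
finitely many data that satisfy it are interpolated by a function of the class
(`exists_mem_funClass`). After subtracting `σ / 2 ‖·‖²`, such a function is the maximum of
`⟨v, x⟩ + c - τ / 2 ‖v‖²` over the convex hull of the slopes and offsets `(v, c)` of the data, with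
`τ = 1 / (β - σ)`. Optimality of the maximizers extends the interpolation inequality to all pairs
of points, and this implies smoothness. The case `β = ∞` is `τ = 0`.

*Duality.* A certificate of the semidefinite program implies the Lyapunov inequality since positive
semidefinite quadratic forms are nonnegative on tuples of vectors. For the converse, every positive
semidefinite matrix of order `n + 3m - 1` is a Gram matrix of vectors of `H`, hence the Lyapunov
inequality is an implication between linear inequalities over positive definite matrices. Its
multipliers come from separating an open convex set from a polyhedral cone, followed by Farkas'
lemma (`exists_multipliers`). The Slater point excludes a separating functional that
gives the objective the multiplier zero; the constraints, being linear, need not be strict there.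
-/

namespace LyapunovAnalysis

/-! ### Interpolation by functions of the class -/

section Interpolation

variable {H : Type*} [NormedAddCommGroup H] [InnerProductSpace ℝ H]

/-- The parameter `1 / (β - σ)`, with the value `0` for `β = ∞`. -/
noncomputable def gapCoeff (σ : ℝ≥0) (β : ℝ≥0∞) : ℝ := ((β - σ)⁻¹).toReal

/-- The lower bound on `f x - f y`, for `f` in the class with parameters `σ, β`, in terms of
`d = x - y`, a subgradient `u` at `x` and a subgradient `v` at `y`. -/
noncomputable def interpGap (σ : ℝ≥0) (β : ℝ≥0∞) (d u v : H) : ℝ :=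
  inner ℝ v d + (σ : ℝ) / 2 * ‖d‖ ^ 2 + gapCoeff σ β / 2 * ‖u - v - (σ : ℝ) • d‖ ^ 2

lemma gapCoeff_nonneg (σ : ℝ≥0) (β : ℝ≥0∞) : 0 ≤ gapCoeff σ β := ENNReal.toReal_nonneg

lemma gapCoeff_top (σ : ℝ≥0) : gapCoeff σ ⊤ = 0 := by simp [gapCoeff]

lemma gapCoeff_of_ne_top {σ : ℝ≥0} {β : ℝ≥0∞} (h : (σ : ℝ≥0∞) < β) (hβ : β ≠ ⊤) :
    gapCoeff σ β = (β.toReal - σ)⁻¹ := by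
  rw [gapCoeff, ENNReal.toReal_inv, ENNReal.toReal_sub_of_le h.le hβ, ENNReal.coe_toReal]

lemma toReal_sub_pos {σ : ℝ≥0} {β : ℝ≥0∞} (h : (σ : ℝ≥0∞) < β) (hβ : β ≠ ⊤) :
    0 < β.toReal - σ := by
  have := (ENNReal.toReal_lt_toReal ENNReal.coe_ne_top hβ).2 h
  simp only [ENNReal.coe_toReal] at this
  linarith

lemma add_le_of_forall_add_mul_le {X Y s : ℝ} (hs : 0 ≤ s)
    (h : ∀ r : ℝ, 0 < r → r ≤ 1 → X + (1 - r) * s ≤ Y) : X + s ≤ Y := by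
  refine le_of_forall_pos_le_add fun ε hε => ?_
  have h0 : 0 < min 1 (ε / (s + 1)) := lt_min one_pos (by positivity)
  have h1 := h _ h0 (min_le_left _ _)
  have h2 : min 1 (ε / (s + 1)) * (s + 1) ≤ ε := by
    rw [← le_div_iff₀ (by positivity)]; exact min_le_right _ _
  nlinarith

lemma norm_sq_segment (x y : H) (r : ℝ) :
    ‖(1 - r) • x + r • y‖ ^ 2 =
      (1 - r) * ‖x‖ ^ 2 + r * ‖y‖ ^ 2 - r * (1 - r) * ‖y - x‖ ^ 2 := by
  simp only [← real_inner_self_eq_norm_sq, inner_add_left, inner_add_right, inner_sub_left,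
    inner_sub_right, real_inner_smul_left, real_inner_smul_right, real_inner_comm x y]
  ring

/-- A subgradient inequality improves by the quadratic term that strong convexity provides. -/
lemma StronglyConvexFun.quadratic_growth {σ : ℝ≥0} {f : H → EReal} (hf : StronglyConvexFun σ f)
    {x y v : H} {a b : ℝ} (ha : (a : EReal) = f x) (hb : (b : EReal) = f y)
    (hv : v ∈ subdiff f y) :
    b + inner ℝ v (x - y) + (σ : ℝ) / 2 * ‖x - y‖ ^ 2 ≤ a := by
  refine add_le_of_forall_add_mul_le (by positivity) fun r hr hr1 => ?_
  have hc := hf.2 y x r hr.le hr1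
  have hs := hv ((1 - r) • y + r • x)
  have hn := norm_sq_segment y x r
  have hz : (1 - r) • y + r • x - y = r • (x - y) := by module
  rw [hz, real_inner_smul_right, ← hb] at hs
  simp only [← ha, ← hb, ← EReal.coe_sub, ← EReal.coe_mul, ← EReal.coe_add] at hc hs
  generalize f ((1 - r) • y + r • x) = c at hc hs
  induction c using EReal.rec with
  | bot => exact absurd (le_bot_iff.1 hs) (EReal.coe_ne_bot _)
  | top =>
    rw [EReal.top_sub_coe] at hc
    exact absurd (top_le_iff.1 hc) (EReal.coe_ne_top _)
  | coe c =>
    rw [← EReal.coe_sub, EReal.coe_le_coe_iff, hn] at hc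
    rw [EReal.coe_le_coe_iff] at hs
    have : r * (b + inner ℝ v (x - y) + (1 - r) * ((σ : ℝ) / 2 * ‖x - y‖ ^ 2)) ≤ r * a := by
      nlinarith
    exact le_of_mul_le_mul_left this hr

/-- The descent lemma. -/
lemma le_add_of_lipschitz_gradient [CompleteSpace H] {g : H → ℝ} {β : ℝ}
    (hg : Differentiable ℝ g) (hL : ∀ x y, ‖gradient g x - gradient g y‖ ≤ β * ‖x - y‖)
    (x d : H) : g (x + d) ≤ g x + inner ℝ (gradient g x) d + β / 2 * ‖d‖ ^ 2 := by
  let ψ : ℝ → ℝ := fun t =>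
    g (x + t • d) - t * inner ℝ (gradient g x) d - β * t ^ 2 / 2 * ‖d‖ ^ 2
  have hψ : ∀ t, HasDerivAt ψ (inner ℝ (gradient g (x + t • d)) d - inner ℝ (gradient g x) d
      - β * t * ‖d‖ ^ 2) t := by
    intro t
    have h1 : HasDerivAt (fun t : ℝ => x + t • d) d t := by
      simpa using ((hasDerivAt_id t).smul_const d).const_add x
    have h2 := (hg (x + t • d)).hasGradientAt.hasFDerivAt.comp_hasDerivAt t h1
    have h3 := (hasDerivAt_id t).mul_const (inner ℝ (gradient g x) d)
    have h4 := ((((hasDerivAt_id t).pow 2).const_mul β).div_const 2).mul_const (‖d‖ ^ 2)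
    refine ((h2.sub h3).sub h4).congr_deriv ?_
    simp only [InnerProductSpace.toDual_apply_apply, id_eq, Nat.cast_ofNat]
    ring
  have hanti : AntitoneOn ψ (Set.Icc 0 1) := by
    refine antitoneOn_of_deriv_nonpos (convex_Icc 0 1)
      (fun t _ => (hψ t).continuousAt.continuousWithinAt)
      (fun t _ => (hψ t).differentiableAt.differentiableWithinAt) fun t ht => ?_
    rw [interior_Icc] at ht
    rw [(hψ t).deriv, ← inner_sub_left]
    have h1 := real_inner_le_norm (gradient g (x + t • d) - gradient g x) d
    have h2 := hL (x + t • d) x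
    rw [add_sub_cancel_left, norm_smul, Real.norm_of_nonneg ht.1.le] at h2
    have h3 := mul_le_mul_of_nonneg_right h2 (norm_nonneg d)
    nlinarith
  have := hanti (Set.left_mem_Icc.2 zero_le_one) (Set.right_mem_Icc.2 zero_le_one) zero_le_one
  simp only [ψ, one_smul, zero_smul, add_zero] at this
  linarith

lemma eq_gradient_of_mem_subdiff [CompleteSpace H] {g : H → ℝ} {x u : H}
    (hg : DifferentiableAt ℝ g x) (hu : u ∈ subdiff (fun x => (g x : EReal)) x) :
    u = gradient g x := by
  have hmin : IsLocalMin (fun y => g y - innerSL ℝ u y) x := by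
    refine Filter.Eventually.of_forall fun y => ?_
    have := hu y
    rw [← EReal.coe_add, EReal.coe_le_coe_iff, inner_sub_right] at this
    simp only [innerSL_apply_apply]
    linarith
  have h := hmin.hasFDerivAt_eq_zero
    (hg.hasGradientAt.hasFDerivAt.sub (innerSL ℝ u).hasFDerivAt)
  refine (ext_inner_right ℝ fun v => ?_)
  have := congrArg (fun l => l v) h
  simp only [sub_apply, InnerProductSpace.toDual_apply_apply,
    innerSL_apply_apply, zero_apply] at this
  linarith

/-- The interpolation inequality holds for every function of the class: compare, at a minimizer of
their difference, the lower bound from strong convexity at `y` with the upper bound from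
smoothness at `x`. -/
theorem interpGap_le [CompleteSpace H] {σ : ℝ≥0} {β : ℝ≥0∞} (hσβ : (σ : ℝ≥0∞) < β)
    {f : H → EReal} (hf : f ∈ FunClass σ β) {x y u v : H} {a b : ℝ} (ha : (a : EReal) = f x)
    (hb : (b : EReal) = f y) (hu : u ∈ subdiff f x) (hv : v ∈ subdiff f y) :
    interpGap σ β (x - y) u v ≤ a - b := by
  obtain ⟨-, hsc, hsm, -⟩ := hf
  by_cases hβ : β = ⊤
  · have := hsc.quadratic_growth ha hb hv
    rw [interpGap, hβ, gapCoeff_top]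
    linarith
  · obtain ⟨g, hfg, hg, hL⟩ := hsm hβ
    obtain rfl : f = fun x => (g x : EReal) := funext hfg
    obtain rfl : a = g x := EReal.coe_injective ha
    obtain rfl : b = g y := EReal.coe_injective hb
    have hL0 := toReal_sub_pos hσβ hβ
    rw [interpGap, gapCoeff_of_ne_top hσβ hβ]
    change ∀ x y, ‖gradient g x - gradient g y‖ ≤ β.toReal * ‖x - y‖ at hL
    generalize β.toReal = β' at hL0 hL
    obtain ⟨L, hLdef⟩ : ∃ L, L = β' - σ := ⟨_, rfl⟩
    rw [← hLdef] at hL0 ⊢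
    obtain rfl : β' = L + σ := by linarith
    -- The difference of the two quadratic bounds is minimal at `x + L⁻¹ • w`.
    obtain ⟨w, hw⟩ : ∃ w, w = v - u + (σ : ℝ) • (x - y) := ⟨_, rfl⟩
    have h1 := hsc.quadratic_growth (x := x + L⁻¹ • w) rfl rfl hv
    have h2 := le_add_of_lipschitz_gradient hg hL x (L⁻¹ • w)
    rw [← eq_gradient_of_mem_subdiff (hg x) hu] at h2
    have h3 : u - v - (σ : ℝ) • (x - y) = -w := by rw [hw]; module
    have h4 : x + L⁻¹ • w - y = (x - y) + L⁻¹ • w := by abel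
    obtain ⟨d, hd⟩ : ∃ d, d = x - y := ⟨_, rfl⟩
    rw [h4, ← hd] at h1
    rw [h3, norm_neg, ← hd]
    rw [← hd] at hw
    have h5 : inner ℝ u w = inner ℝ v w + (σ : ℝ) * inner ℝ d w - ‖w‖ ^ 2 := by
      have : u = v + (σ : ℝ) • d - w := by rw [hw]; module
      rw [this, inner_sub_left, inner_add_left, real_inner_smul_left, real_inner_self_eq_norm_sq]
    rw [norm_add_sq_real, inner_add_right, real_inner_smul_right, real_inner_smul_right, norm_smul,
      Real.norm_of_nonneg (inv_nonneg.2 hL0.le)] at h1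
    rw [real_inner_smul_right, norm_smul, Real.norm_of_nonneg (inv_nonneg.2 hL0.le), h5] at h2
    have h6 : (L + σ) / 2 * (L⁻¹ * ‖w‖) ^ 2
        = L⁻¹ / 2 * ‖w‖ ^ 2 + (σ : ℝ) / 2 * (L⁻¹ * ‖w‖) ^ 2 := by
      field_simp
    rw [h6] at h2
    linarith

/-- The maximum of the concave quadratic functions `k ↦ ⟨k.1, x⟩ + k.2 - τ / 2 ‖k.1‖²` over a
compact convex set: `p x` is the slope of a maximizer. -/
lemma exists_quadratic_support {s : Set (H × ℝ)} (hs : IsCompact s) (hc : Convex ℝ s)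
    (hne : s.Nonempty) {τ : ℝ} (hτ : 0 ≤ τ) :
    ∃ (h : H → ℝ) (p : H → H),
      (∀ x, ∀ k ∈ s, inner ℝ k.1 x + k.2 - τ / 2 * ‖k.1‖ ^ 2 ≤ h x) ∧
      (∀ x, ∃ k ∈ s, inner ℝ k.1 x + k.2 - τ / 2 * ‖k.1‖ ^ 2 = h x) ∧
      ∀ x y, h y + inner ℝ (p y) (x - y) + τ / 2 * ‖p x - p y‖ ^ 2 ≤ h x := by
  have hmax : ∀ x : H, ∃ k ∈ s, IsMaxOn
      (fun k : H × ℝ => inner ℝ k.1 x + k.2 - τ / 2 * ‖k.1‖ ^ 2) s k := fun x =>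
    hs.exists_isMaxOn hne (by fun_prop)
  choose k hks hkmax using hmax
  refine ⟨fun x => inner ℝ (k x).1 x + (k x).2 - τ / 2 * ‖(k x).1‖ ^ 2, fun x => (k x).1,
    fun x l hl => hkmax x hl, fun x => ⟨k x, hks x, rfl⟩, fun x y => ?_⟩
  have hy : inner ℝ (k y).1 (x - y) = inner ℝ (k y).1 x - inner ℝ (k y).1 y :=
    inner_sub_right _ _ _
  have key : (inner ℝ (k y).1 x + (k y).2 - τ / 2 * ‖(k y).1‖ ^ 2)
      + τ / 2 * ‖(k y).1 - (k x).1‖ ^ 2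
      ≤ inner ℝ (k x).1 x + (k x).2 - τ / 2 * ‖(k x).1‖ ^ 2 := by
    refine add_le_of_forall_add_mul_le (by positivity) fun r hr hr1 => ?_
    have h1 := hkmax x (hc (hks x) (hks y) (sub_nonneg.2 hr1) hr.le (sub_add_cancel 1 r))
    simp only [Set.mem_ofPred_eq, Prod.fst_add, Prod.snd_add, Prod.smul_fst, Prod.smul_snd,
      norm_sq_segment, inner_add_left, real_inner_smul_left, smul_eq_mul] at h1
    refine le_of_mul_le_mul_left ?_ hr
    nlinarith
  rw [norm_sub_rev, hy]
  linarith

/-- Finitely many triples of points, slopes and values that satisfy the interpolation inequality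
with `σ = 0` extend to a function and a slope field that satisfy this inequality everywhere. The
function is the conjugate of a `τ`-strongly convex function whose domain is the convex hull of the
given slopes. -/
lemma exists_extension {ι : Type*} [Finite ι] [Nonempty ι] {τ : ℝ} (hτ : 0 ≤ τ)
    (y v : ι → H) (F : ι → ℝ)
    (h : ∀ i j, F j + inner ℝ (v j) (y i - y j) + τ / 2 * ‖v i - v j‖ ^ 2 ≤ F i) :
    ∃ (g : H → ℝ) (p : H → H),
      (∀ i, g (y i) = F i) ∧ (∀ i x, F i + inner ℝ (v i) (x - y i) ≤ g x) ∧
      ∀ x y, g y + inner ℝ (p y) (x - y) + τ / 2 * ‖p x - p y‖ ^ 2 ≤ g x := by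
  let k : ι → H × ℝ := fun j => (v j, F j - inner ℝ (v j) (y j) + τ / 2 * ‖v j‖ ^ 2)
  obtain ⟨g, p, hle, hex, hgp⟩ := exists_quadratic_support
    ((Set.finite_range k).isCompact_convexHull ℝ) (convex_convexHull ℝ _)
    ((Set.range_nonempty k).mono (subset_convexHull ℝ _)) hτ
  have hlow : ∀ i x, F i + inner ℝ (v i) (x - y i) ≤ g x := by
    intro i x
    have := hle x (k i) (subset_convexHull ℝ _ ⟨i, rfl⟩)
    simp only [k] at this
    rw [inner_sub_right]
    linarith
  refine ⟨g, p, fun i => le_antisymm ?_ (by simpa using hlow i (y i)), hlow, hgp⟩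
  obtain ⟨l, hl, hgl⟩ := hex (y i)
  -- The slopes and offsets in the convex hull satisfy the linear inequality which the
  -- interpolation inequality becomes at the shifted point `y i - τ • v i`.
  have hlin : inner ℝ l.1 (y i - τ • v i) + l.2 ≤ F i - τ / 2 * ‖v i‖ ^ 2 := by
    have hconv : Convex ℝ {l : H × ℝ | inner ℝ l.1 (y i - τ • v i) + l.2
        ≤ F i - τ / 2 * ‖v i‖ ^ 2} := by
      intro a ha b hb s t hs ht hst
      simp only [Set.mem_ofPred_eq, Prod.fst_add, Prod.snd_add, Prod.smul_fst, Prod.smul_snd,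
        inner_add_left, real_inner_smul_left, smul_eq_mul] at *
      calc _ = s * (inner ℝ a.1 (y i - τ • v i) + a.2)
            + t * (inner ℝ b.1 (y i - τ • v i) + b.2) := by ring
        _ ≤ s * (F i - τ / 2 * ‖v i‖ ^ 2) + t * (F i - τ / 2 * ‖v i‖ ^ 2) := by gcongr
        _ = _ := by rw [← add_mul, hst, one_mul]
    refine convexHull_min ?_ hconv hl
    rintro _ ⟨j, rfl⟩
    have := h i j
    rw [inner_sub_right, norm_sub_sq_real] at this
    simp only [k, Set.mem_ofPred_eq, inner_sub_right, real_inner_smul_right]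
    rw [real_inner_comm (v j) (v i)] at *
    linarith
  have hsq : 0 ≤ τ / 2 * ‖l.1 - v i‖ ^ 2 := by positivity
  rw [norm_sub_sq_real] at hsq
  rw [inner_sub_right, real_inner_smul_right] at hlin
  linarith

lemma convexOn_of_subgradients {g : H → ℝ} {p : H → H}
    (h : ∀ x y, g y + inner ℝ (p y) (x - y) ≤ g x) : ConvexOn ℝ Set.univ g := by
  refine ⟨convex_univ, fun x _ y _ a b ha hb hab => ?_⟩
  have hx := mul_le_mul_of_nonneg_left (h x (a • x + b • y)) ha
  have hy := mul_le_mul_of_nonneg_left (h y (a • x + b • y)) hb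
  obtain rfl : a = 1 - b := by linarith
  have h1 : x - ((1 - b) • x + b • y) = b • (x - y) := by module
  have h2 : y - ((1 - b) • x + b • y) = -((1 - b) • (x - y)) := by module
  rw [h1, real_inner_smul_right] at hx
  rw [h2, inner_neg_right, real_inner_smul_right] at hy
  simp only [smul_eq_mul]
  linarith

lemma hasGradientAt_of_abs_le [CompleteSpace H] {g : H → ℝ} {p x : H} {c : ℝ}
    (h : ∀ y, |g y - g x - inner ℝ p (y - x)| ≤ c * ‖y - x‖ ^ 2) : HasGradientAt g p x := by
  rw [hasGradientAt_iff_isLittleO]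
  refine Asymptotics.IsBigO.trans_isLittleO (g := fun y => ‖y - x‖ ^ 2) ?_ ?_
  · refine Asymptotics.IsBigO.of_bound c (Filter.Eventually.of_forall fun y => ?_)
    simpa using h y
  · have h1 : Filter.Tendsto (fun y => y - x) (nhds x) (nhds 0) := by
      have : Continuous fun y : H => y - x := by fun_prop
      simpa using this.tendsto x
    have := (Asymptotics.isLittleO_norm_pow_id one_lt_two).comp_tendsto h1
    exact this

/-- A function that satisfies the interpolation inequality everywhere, with `τ = 1 / (β - σ)` and
a slope field `p`, belongs to the class once the quadratic is added back: the inequality bounds the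
function above and below by quadratics, so `p` is its gradient, and it makes `p` cocoercive. -/
lemma mem_funClass_of_extension [CompleteSpace H] {σ : ℝ≥0} {β : ℝ≥0∞}
    (hσβ : (σ : ℝ≥0∞) < β) {g : H → ℝ} {p : H → H}
    (h : ∀ x y, g y + inner ℝ (p y) (x - y) + gapCoeff σ β / 2 * ‖p x - p y‖ ^ 2 ≤ g x) :
    (fun x => ((g x + (σ : ℝ) / 2 * ‖x‖ ^ 2 : ℝ) : EReal)) ∈ FunClass σ β := by
  have hsub : ∀ x y, g y + inner ℝ (p y) (x - y) ≤ g x := fun x y =>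
    le_trans (le_add_of_nonneg_right (by have := gapCoeff_nonneg σ β; positivity)) (h x y)
  have hconv := convexOn_of_subgradients hsub
  refine ⟨fun x => EReal.coe_ne_bot _, ⟨⟨0, EReal.coe_lt_top _⟩, fun x y r hr hr1 => ?_⟩,
    fun hβ => ?_, fun _ => ?_⟩
  · have := hconv.2 (Set.mem_univ x) (Set.mem_univ y) (sub_nonneg.2 hr1) hr (sub_add_cancel 1 r)
    simp only [← EReal.coe_sub, ← EReal.coe_mul, ← EReal.coe_add, EReal.coe_le_coe_iff,
      add_sub_cancel_right]
    exact this
  · have hL := toReal_sub_pos hσβ hβ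
    rw [gapCoeff_of_ne_top hσβ hβ] at h
    obtain ⟨L, hLdef⟩ : ∃ L, L = β.toReal - σ := ⟨_, rfl⟩
    rw [← hLdef] at h hL
    have hgrad : ∀ x, HasGradientAt g (p x) x := by
      intro x
      refine hasGradientAt_of_abs_le (c := L / 2) fun y => abs_le.2 ⟨?_, ?_⟩
      · have h1 := hsub y x
        have h2 : 0 ≤ L / 2 * ‖y - x‖ ^ 2 := by positivity
        linarith
      · have h1 := h x y
        have h2 : 0 ≤ L⁻¹ / 2 * ‖p x - p y + L • (y - x)‖ ^ 2 := by positivity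
        have h3 : L⁻¹ / 2 * ‖p x - p y + L • (y - x)‖ ^ 2 = L⁻¹ / 2 * ‖p x - p y‖ ^ 2
            + (inner ℝ (p x) (y - x) - inner ℝ (p y) (y - x)) + L / 2 * ‖y - x‖ ^ 2 := by
          rw [norm_add_sq_real, real_inner_smul_right, norm_smul, inner_sub_left,
            Real.norm_of_nonneg hL.le]
          field_simp
        have h4 : inner ℝ (p y) (x - y) = - inner ℝ (p y) (y - x) := by
          rw [← inner_neg_right, neg_sub]
        linarith
    have hlip : ∀ x y, ‖p x - p y‖ ≤ L * ‖x - y‖ := by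
      intro x y
      have h1 := h x y
      have h2 := h y x
      rw [norm_sub_rev] at h2
      have h4 : inner ℝ (p x) (y - x) = - inner ℝ (p x) (x - y) := by
        rw [← inner_neg_right, neg_sub]
      have h5 := real_inner_le_norm (p x - p y) (x - y)
      rw [inner_sub_left] at h5
      by_contra! hlt
      have h6 : L⁻¹ * ‖p x - p y‖ ^ 2 ≤ ‖p x - p y‖ * ‖x - y‖ := by linarith
      have h7 : ‖p x - p y‖ ^ 2 ≤ ‖p x - p y‖ * (L * ‖x - y‖) := by
        calc _ = L * (L⁻¹ * ‖p x - p y‖ ^ 2) := by field_simp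
          _ ≤ L * (‖p x - p y‖ * ‖x - y‖) := by gcongr
          _ = _ := by ring
      have h8 : 0 < ‖p x - p y‖ := lt_of_le_of_lt (by positivity) hlt
      nlinarith
    have hgrad' : ∀ x, HasGradientAt (fun x => g x + (σ : ℝ) / 2 * ‖x‖ ^ 2)
        (p x + (σ : ℝ) • x) x := by
      intro x
      rw [hasGradientAt_iff_hasFDerivAt]
      have h1 := ((hasStrictFDerivAt_norm_sq x).hasFDerivAt).const_mul ((σ : ℝ) / 2)
      refine ((hgrad x).hasFDerivAt.add h1).congr_fderiv ?_
      ext w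
      simp
      ring
    refine ⟨_, fun x => rfl, fun x => (hgrad' x).hasFDerivAt.differentiableAt, fun x y => ?_⟩
    rw [(hgrad' x).gradient, (hgrad' y).gradient]
    change _ ≤ β.toReal * _
    have h1 : p x + (σ : ℝ) • x - (p y + (σ : ℝ) • y) = (p x - p y) + (σ : ℝ) • (x - y) := by
      module
    rw [h1]
    refine (norm_add_le _ _).trans ?_
    rw [norm_smul, Real.norm_of_nonneg σ.coe_nonneg]
    have := hlip x y
    rw [hLdef] at this
    linarith
  · intro x c hc
    have hcont : Continuous fun y : H =>
        ((g x + inner ℝ (p x) (y - x) + (σ : ℝ) / 2 * ‖y‖ ^ 2 : ℝ) : EReal) :=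
      continuous_coe_real_ereal.comp (by fun_prop)
    have hx : c < ((g x + inner ℝ (p x) (x - x) + (σ : ℝ) / 2 * ‖x‖ ^ 2 : ℝ) : EReal) := by
      simpa using hc
    filter_upwards [hcont.tendsto x |>.eventually (lt_mem_nhds hx)] with y hy
    refine hy.trans_le (EReal.coe_le_coe_iff.2 ?_)
    linarith [hsub y x]

/-- Sufficiency of the interpolation inequalities. -/
theorem exists_mem_funClass [CompleteSpace H] {ι : Type*} [Finite ι] [Nonempty ι] {σ : ℝ≥0}
    {β : ℝ≥0∞} (hσβ : (σ : ℝ≥0∞) < β) (y u : ι → H) (F : ι → ℝ)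
    (h : ∀ i j, i ≠ j → interpGap σ β (y i - y j) (u i) (u j) ≤ F i - F j) :
    ∃ f ∈ FunClass σ β, ∀ i, u i ∈ subdiff f (y i) ∧ (F i : EReal) = f (y i) := by
  -- Subtracting `σ / 2 ‖·‖²` reduces the data to the case `σ = 0`.
  obtain ⟨g, p, hval, hsub, hgp⟩ := exists_extension (gapCoeff_nonneg σ β) y
    (fun i => u i - (σ : ℝ) • y i) (fun i => F i - (σ : ℝ) / 2 * ‖y i‖ ^ 2) (by
      intro i j
      rcases eq_or_ne i j with rfl | hij
      · simp
      have := h i j hij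
      rw [interpGap] at this
      have h1 : u i - u j - (σ : ℝ) • (y i - y j)
          = u i - (σ : ℝ) • y i - (u j - (σ : ℝ) • y j) := by
        module
      rw [h1, norm_sub_sq_real (y i)] at this
      rw [inner_sub_left, real_inner_smul_left, inner_sub_right (y j), real_inner_self_eq_norm_sq,
        real_inner_comm (y i) (y j)]
      linarith)
  refine ⟨_, mem_funClass_of_extension hσβ hgp, fun i => ⟨fun x => ?_, by simp [hval]⟩⟩
  rw [← EReal.coe_add, EReal.coe_le_coe_iff, hval]
  have h1 := hsub i x
  rw [inner_sub_left, real_inner_smul_left] at h1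
  have h2 : 0 ≤ (σ : ℝ) / 2 * ‖x - y i‖ ^ 2 := by positivity
  have h3 : ‖x‖ ^ 2 = ‖y i‖ ^ 2 + 2 * inner ℝ (y i) (x - y i) + ‖x - y i‖ ^ 2 := by
    rw [← norm_add_sq_real, add_sub_cancel]
  rw [h3]
  linarith

end Interpolation

/-! ### Conic duality with polyhedral constraints -/

section Duality

/-- Farkas' lemma for finitely many linear functionals on a real vector space. -/
theorem exists_nonneg_sum_eq {E ι : Type*} [AddCommGroup E] [Module ℝ E] [DecidableEq ι]
    (s : Finset ι) (a : ι → E →ₗ[ℝ] ℝ) (φ : E →ₗ[ℝ] ℝ)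
    (h : ∀ v, (∀ k ∈ s, a k v ≤ 0) → φ v ≤ 0) :
    ∃ c : ι → ℝ, (∀ k ∈ s, 0 ≤ c k) ∧ φ = ∑ k ∈ s, c k • a k := by
  induction s using Finset.induction_on generalizing a φ with
  | empty =>
    refine ⟨0, by simp, ?_⟩
    ext v
    have h1 := h v (by simp)
    have h2 := h (-v) (by simp)
    simp only [map_neg] at h2
    simp only [Finset.sum_empty, LinearMap.zero_apply]
    linarith
  | insert j s hj ih =>
    by_cases hs : ∀ v, (∀ k ∈ s, a k v ≤ 0) → φ v ≤ 0
    · obtain ⟨c, hc, rfl⟩ := ih a φ hs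
      refine ⟨fun k => if k = j then 0 else c k, fun k hk => ?_, ?_⟩
      · rcases Finset.mem_insert.1 hk with rfl | hk
        · simp
        · simp only; split_ifs
          exacts [le_rfl, hc k hk]
      · rw [Finset.sum_insert hj]
        beta_reduce
        rw [if_pos rfl, zero_smul, zero_add]
        refine Finset.sum_congr rfl fun k hk => ?_
        rw [if_neg (ne_of_mem_of_not_mem hk hj)]
    · push Not at hs
      obtain ⟨x, hx, hφ⟩ := hs
      have hjx : 0 < a j x := by
        by_contra! hle
        exact absurd (h x (by simpa using ⟨hle, hx⟩)) (not_le.2 hφ)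
      -- Eliminate the functional `a j` by projecting onto its kernel along `x`.
      obtain ⟨c, hc, hφc⟩ := ih (fun k => a k - (a k x / a j x) • a j)
        (φ - (φ x / a j x) • a j) (by
          intro v hv
          have hv' := h (v - (a j v / a j x) • x) (by
            intro k hk
            rcases Finset.mem_insert.1 hk with rfl | hk
            · simp [hjx.ne']
            · have := hv k hk
              simp only [LinearMap.sub_apply, LinearMap.smul_apply, smul_eq_mul, map_sub,
                map_smul] at this ⊢
              calc _ = a k v - a k x / a j x * a j v := by ring
                _ ≤ 0 := this)
          simp only [LinearMap.sub_apply, LinearMap.smul_apply, smul_eq_mul, map_sub,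
            map_smul] at hv' ⊢
          calc _ = φ v - a j v / a j x * φ x := by ring
            _ ≤ 0 := hv')
      refine ⟨fun k => if k = j then φ x / a j x - ∑ k ∈ s, c k * (a k x / a j x) else c k,
        fun k hk => ?_, ?_⟩
      · rcases Finset.mem_insert.1 hk with rfl | hk
        · simp only [if_pos]
          have h1 : ∑ i ∈ s, c i * (a i x / a k x) ≤ 0 := Finset.sum_nonpos fun i hi =>
            mul_nonpos_of_nonneg_of_nonpos (hc i hi)
              (div_nonpos_of_nonpos_of_nonneg (hx i hi) hjx.le)
          have h2 : 0 ≤ φ x / a k x := by positivity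
          linarith
        · simp only [if_neg (ne_of_mem_of_not_mem hk hj)]
          exact hc k hk
      · rw [Finset.sum_insert hj]
        beta_reduce
        rw [if_pos rfl]
        have h1 : ∑ k ∈ s, (if k = j then φ x / a j x - ∑ k ∈ s, c k * (a k x / a j x)
            else c k) • a k = ∑ k ∈ s, c k • a k :=
          Finset.sum_congr rfl fun k hk => by rw [if_neg (ne_of_mem_of_not_mem hk hj)]
        rw [h1]
        simp only [smul_sub, Finset.sum_sub_distrib, smul_smul, ← Finset.sum_smul] at hφc
        have h2 := sub_eq_iff_eq_add.1 hφc
        conv_lhs => rw [h2]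
        module

/-- Lagrange duality with polyhedral constraints: a linear functional that is nonnegative on the
part of an open convex set where finitely many linear functionals are nonpositive becomes
nonnegative on the whole set after adding multiples of the constraints, provided that some point
of the open set satisfies the constraints (not necessarily strictly). -/
theorem exists_multipliers {E ι : Type*} [AddCommGroup E] [Module ℝ E] [TopologicalSpace E]
    [IsTopologicalAddGroup E] [ContinuousSMul ℝ E] [DecidableEq ι] {U : Set E}
    (hU : IsOpen U) (hUc : Convex ℝ U) (s : Finset ι) (a : ι → E →ₗ[ℝ] ℝ) (φ : E →ₗ[ℝ] ℝ)
    (h : ∀ v ∈ U, (∀ k ∈ s, a k v ≤ 0) → 0 ≤ φ v)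
    {v₀ : E} (hv₀ : v₀ ∈ U) (hs : ∀ k ∈ s, a k v₀ ≤ 0) :
    ∃ c : ι → ℝ, (∀ k ∈ s, 0 ≤ c k) ∧ ∀ v ∈ U, 0 ≤ φ v + ∑ k ∈ s, c k * a k v := by
  by_cases hex : ∃ v₁, (∀ k ∈ s, a k v₁ ≤ 0) ∧ φ v₁ < 0
  swap
  · push Not at hex
    obtain ⟨c, hc, hφ⟩ := exists_nonneg_sum_eq s a (-φ) fun v hv => by simpa using hex v hv
    refine ⟨c, hc, fun v _ => ?_⟩
    have := congrArg (fun l => l v) hφ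
    simp only [LinearMap.neg_apply, LinearMap.sum_apply, LinearMap.smul_apply,
      smul_eq_mul] at this
    linarith
  obtain ⟨v₁, hv₁, hφv₁⟩ := hex
  have htc : Convex ℝ {v | (∀ k ∈ s, a k v ≤ 0) ∧ φ v < 0} := by
    rintro x ⟨hx, hx'⟩ y ⟨hy, hy'⟩ p q hp hq hpq
    refine ⟨fun k hk => ?_, ?_⟩
    · simp only [map_add, map_smul, smul_eq_mul]
      nlinarith [mul_nonneg hp (neg_nonneg.2 (hx k hk)), mul_nonneg hq (neg_nonneg.2 (hy k hk))]
    · exact (convex_halfSpace_lt φ.isLinear 0) hx' hy' hp hq hpq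
  obtain ⟨f, u, hfU, hft⟩ := geometric_hahn_banach_open hUc hU htc (by
    rw [Set.disjoint_left]
    exact fun v hv hv' => absurd (h v hv hv'.1) (not_le.2 hv'.2))
  -- The set separated from `U` is a cone, so the separating functional is nonnegative on it, and
  -- negative on `U`.
  have hscale : ∀ v, (∀ k ∈ s, a k v ≤ 0) → φ v < 0 → ∀ r : ℝ, 0 < r → u ≤ r * f v := by
    intro v hv hv' r hr
    have := hft (r • v) ⟨fun k hk => by
      simpa using mul_nonpos_of_nonneg_of_nonpos hr.le (hv k hk), by
      simpa using mul_neg_of_pos_of_neg hr hv'⟩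
    simpa using this
  have hu : u ≤ 0 := by
    refine le_of_forall_pos_le_add fun ε hε => ?_
    rcases le_or_gt (f v₁) 0 with h0 | h0
    · have := hscale v₁ hv₁ hφv₁ 1 one_pos
      linarith
    · have := hscale v₁ hv₁ hφv₁ (ε / f v₁) (by positivity)
      rw [div_mul_cancel₀ _ h0.ne'] at this
      linarith
  have hf0 : ∀ v, (∀ k ∈ s, a k v ≤ 0) → φ v < 0 → 0 ≤ f v := by
    intro v hv hv'
    by_contra! hneg
    have := hscale v hv hv' ((u - 1) / f v) (div_pos_of_neg_of_neg (by linarith) hneg)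
    rw [div_mul_cancel₀ _ hneg.ne] at this
    linarith
  -- Perturbation in the direction `v₁` replaces the strict inequality by a nonstrict one.
  have hf1 : ∀ v, (∀ k ∈ s, a k v ≤ 0) → φ v ≤ 0 → 0 ≤ f v := by
    intro v hv hv'
    refine le_of_forall_pos_le_add fun ε hε => ?_
    have h1 := hf0 v₁ hv₁ hφv₁
    have hδ : 0 < ε / (f v₁ + 1) := by positivity
    have h2 := hf0 (v + (ε / (f v₁ + 1)) • v₁)
      (fun k hk => by
        simp only [map_add, map_smul, smul_eq_mul]
        nlinarith [hv k hk, mul_nonneg hδ.le (neg_nonneg.2 (hv₁ k hk))])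
      (by
        simp only [map_add, map_smul, smul_eq_mul]
        nlinarith [mul_pos hδ (neg_pos.2 hφv₁)])
    simp only [map_add, map_smul, smul_eq_mul] at h2
    have h3 : ε / (f v₁ + 1) * (f v₁ + 1) = ε := div_mul_cancel₀ _ (by positivity)
    nlinarith
  obtain ⟨c, hc, hfc⟩ := exists_nonneg_sum_eq (Finset.insertNone s)
    (fun k => k.elim φ a) (-(f : E →ₗ[ℝ] ℝ)) (by
      intro v hv
      have h1 : φ v ≤ 0 := hv none (by simp)
      have h2 : ∀ k ∈ s, a k v ≤ 0 := fun k hk => hv (some k) (by simpa using hk)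
      simpa using hf1 v h2 h1)
  have hfc' : ∀ v, -f v = c none * φ v + ∑ k ∈ s, c (some k) * a k v := by
    intro v
    have := congrArg (fun l => l v) hfc
    simpa [Finset.sum_insertNone] using this
  have hcs : ∀ k ∈ s, 0 ≤ c (some k) := fun k hk => hc _ (by simpa using hk)
  -- The multiplier of `φ` does not vanish: evaluate at the point that satisfies the constraints.
  have hμ : 0 < c none := by
    refine lt_of_le_of_ne (hc none (by simp)) fun h0 => ?_
    have h1 := hfc' v₀
    rw [← h0, zero_mul, zero_add] at h1
    have h2 : ∑ k ∈ s, c (some k) * a k v₀ ≤ 0 := Finset.sum_nonpos fun k hk =>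
      mul_nonpos_of_nonneg_of_nonpos (hcs k hk) (hs k hk)
    linarith [hfU v₀ hv₀]
  refine ⟨fun k => c (some k) / c none, fun k hk => div_nonneg (hcs k hk) hμ.le,
    fun v hv => ?_⟩
  have h1 : φ v + ∑ k ∈ s, c (some k) / c none * a k v = -f v / c none := by
    rw [hfc', add_div, Finset.sum_div, mul_div_cancel_left₀ _ hμ.ne']
    congr 1
    exact Finset.sum_congr rfl fun k _ => by ring
  rw [h1]
  exact div_nonneg (by linarith [hfU v hv]) hμ.le

end Duality

section PositiveMatrices

variable {κ : Type*} [Fintype κ]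

/-- The matrices, symmetric or not, whose quadratic form is positive away from `0`. -/
def posForm (κ : Type*) [Fintype κ] : Set (Matrix κ κ ℝ) :=
  {G | ∀ x : κ → ℝ, x ≠ 0 → 0 < x ⬝ᵥ G.mulVec x}

lemma isOpen_posForm : IsOpen (posForm κ) := by
  have hset : posForm κ = {G | ∀ x ∈ Metric.sphere (0 : κ → ℝ) 1, 0 < x ⬝ᵥ G.mulVec x} := by
    ext G
    refine ⟨fun h x hx => h x (by rintro rfl; simp at hx), fun h x hx => ?_⟩
    have hn : 0 < ‖x‖ := norm_pos_iff.2 hx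
    have := h (‖x‖⁻¹ • x) (by simp [norm_smul, hn.ne'])
    rw [Matrix.mulVec_smul, dotProduct_smul, smul_dotProduct, smul_eq_mul, smul_eq_mul] at this
    exact (mul_pos_iff_of_pos_left (inv_pos.2 hn)).1
      ((mul_pos_iff_of_pos_left (inv_pos.2 hn)).1 this)
  rw [hset, isOpen_iff_eventually]
  intro G hG
  refine (isCompact_sphere (0 : κ → ℝ) 1).eventually_forall_of_forall_eventually fun x hx => ?_
  have hcont : Continuous fun q : Matrix κ κ ℝ × (κ → ℝ) => q.2 ⬝ᵥ q.1.mulVec q.2 := by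
    fun_prop
  exact hcont.continuousAt.eventually (lt_mem_nhds (hG x hx))

lemma convex_posForm : Convex ℝ (posForm κ) := by
  intro G hG G' hG' a b ha hb hab x hx
  rw [Matrix.add_mulVec, Matrix.smul_mulVec, Matrix.smul_mulVec, dotProduct_add, dotProduct_smul,
    dotProduct_smul]
  exact (convex_Ioi (0 : ℝ)) (hG x hx) (hG' x hx) ha hb hab

lemma mem_posForm_of_posDef {G : Matrix κ κ ℝ} (hG : G.PosDef) : G ∈ posForm κ := fun x hx => by
  simpa using hG.dotProduct_mulVec_pos hx

/-- The symmetric part of a matrix. -/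
noncomputable def symPart (G : Matrix κ κ ℝ) : Matrix κ κ ℝ := (1 / 2 : ℝ) • (G + G.transpose)

lemma posDef_symPart {G : Matrix κ κ ℝ} (hG : G ∈ posForm κ) : (symPart G).PosDef := by
  refine Matrix.PosDef.of_dotProduct_mulVec_pos ?_ fun x hx => ?_
  · rw [Matrix.IsHermitian, Matrix.conjTranspose_eq_transpose_of_trivial, symPart,
      Matrix.transpose_smul, Matrix.transpose_add, Matrix.transpose_transpose, add_comm]
  · have h1 : x ⬝ᵥ G.transpose.mulVec x = x ⬝ᵥ G.mulVec x := by
      rw [Matrix.mulVec_transpose, dotProduct_comm, Matrix.dotProduct_mulVec]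
    rw [star_trivial, symPart, Matrix.smul_mulVec, Matrix.add_mulVec, dotProduct_smul,
      dotProduct_add, h1, smul_eq_mul]
    linarith [hG x hx]

lemma trace_mul_symPart {M : Matrix κ κ ℝ} (hM : M.IsSymm) (G : Matrix κ κ ℝ) :
    (M * symPart G).trace = (M * G).trace := by
  have h1 : (M * G.transpose).trace = (M * G).trace := by
    rw [← Matrix.trace_transpose, Matrix.transpose_mul, Matrix.transpose_transpose, hM.eq,
      Matrix.trace_mul_comm]
  rw [symPart, Matrix.mul_smul, Matrix.trace_smul, Matrix.mul_add, Matrix.trace_add, h1,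
    smul_eq_mul]
  ring

lemma posSemidef_of_forall_posForm [DecidableEq κ] {W : Matrix κ κ ℝ} (hW : W.IsSymm)
    (h : ∀ G ∈ posForm κ, 0 ≤ (W * G).trace) : W.PosSemidef := by
  refine Matrix.PosSemidef.of_dotProduct_mulVec_nonneg
    (by rw [Matrix.IsHermitian, Matrix.conjTranspose_eq_transpose_of_trivial, hW.eq]) fun x => ?_
  rw [star_trivial]
  refine le_of_forall_pos_le_add fun ε hε => ?_
  obtain ⟨δ, hδ, hδε⟩ : ∃ δ : ℝ, 0 < δ ∧ δ * W.trace ≤ ε := by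
    refine ⟨ε / (|W.trace| + 1), by positivity, ?_⟩
    calc _ ≤ ε / (|W.trace| + 1) * (|W.trace| + 1) := by
          gcongr
          linarith [le_abs_self W.trace]
      _ = ε := div_mul_cancel₀ _ (by positivity)
  have h1 := h (Matrix.vecMulVec x x + δ • 1) fun y hy => by
    have hyy : 0 < y ⬝ᵥ y := by simpa using Matrix.dotProduct_star_self_pos_iff.2 hy
    have h2 : y ⬝ᵥ (Matrix.vecMulVec x x).mulVec y = (x ⬝ᵥ y) ^ 2 := by
      rw [Matrix.vecMulVec_mulVec, op_smul_eq_smul, dotProduct_smul, smul_eq_mul,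
        dotProduct_comm y x, sq]
    rw [Matrix.add_mulVec, Matrix.smul_mulVec, Matrix.one_mulVec, dotProduct_add, h2,
      dotProduct_smul, smul_eq_mul]
    positivity
  rw [Matrix.mul_add, Matrix.trace_add, Matrix.mul_smul, Matrix.trace_smul, Matrix.mul_one,
    Matrix.mul_vecMulVec, Matrix.trace_vecMulVec, dotProduct_comm, smul_eq_mul] at h1
  linarith

/-- Dual multipliers of a semidefinite program with finitely many linear inequality constraints
that are satisfied, not necessarily strictly, at a positive definite matrix. -/
theorem exists_sdp_multipliers [DecidableEq κ] {ι κ' : Type*} [DecidableEq ι] [Fintype κ']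
    (s : Finset ι) {M : ι → Matrix κ κ ℝ} (hM : ∀ k, (M k).IsSymm) (a : ι → κ' → ℝ)
    {W : Matrix κ κ ℝ} (hW : W.IsSymm) (w : κ' → ℝ)
    (h : ∀ (G : Matrix κ κ ℝ) (χ : κ' → ℝ), G.PosDef →
      (∀ k ∈ s, a k ⬝ᵥ χ + (M k * G).trace ≤ 0) → 0 ≤ w ⬝ᵥ χ + (W * G).trace)
    {G₀ : Matrix κ κ ℝ} {χ₀ : κ' → ℝ} (hG₀ : G₀.PosDef)
    (h₀ : ∀ k ∈ s, a k ⬝ᵥ χ₀ + (M k * G₀).trace ≤ 0) :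
    ∃ c : ι → ℝ, (∀ k ∈ s, 0 ≤ c k) ∧ (W + ∑ k ∈ s, c k • M k).PosSemidef ∧
      w + ∑ k ∈ s, c k • a k = 0 := by
  let L : (κ' → ℝ) → Matrix κ κ ℝ → (Matrix κ κ ℝ × (κ' → ℝ)) →ₗ[ℝ] ℝ := fun b N =>
    { toFun := fun v => b ⬝ᵥ v.2 + (N * v.1).trace
      map_add' := fun v v' => by
        simp only [Prod.fst_add, Prod.snd_add, dotProduct_add, Matrix.mul_add, Matrix.trace_add]
        ring
      map_smul' := fun r v => by
        simp only [Prod.smul_fst, Prod.smul_snd, dotProduct_smul, Matrix.mul_smul,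
          Matrix.trace_smul, smul_eq_mul, RingHom.id_apply]
        ring }
  have hL : ∀ b N v, L b N v = b ⬝ᵥ v.2 + (N * v.1).trace := fun _ _ _ => rfl
  obtain ⟨c, hc, hpos⟩ := exists_multipliers
    (isOpen_posForm.prod (isOpen_univ (X := κ' → ℝ))) (convex_posForm.prod convex_univ) s
    (fun k => L (a k) (M k)) (L w W) (by
      rintro ⟨G, χ⟩ ⟨hG, -⟩ hv
      have := h (symPart G) χ (posDef_symPart hG) fun k hk => by
        rw [trace_mul_symPart (hM k)]
        exact hv k hk
      rwa [trace_mul_symPart hW] at this)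
    (v₀ := (G₀, χ₀)) ⟨mem_posForm_of_posDef hG₀, trivial⟩ h₀
  have hpos' : ∀ G ∈ posForm κ, ∀ χ : κ' → ℝ,
      0 ≤ (w + ∑ k ∈ s, c k • a k) ⬝ᵥ χ + ((W + ∑ k ∈ s, c k • M k) * G).trace := by
    intro G hG χ
    have := hpos (G, χ) ⟨hG, trivial⟩
    simp only [hL, mul_add, Finset.sum_add_distrib] at this
    simp only [add_dotProduct, sum_dotProduct, smul_dotProduct, Matrix.add_mul, Matrix.sum_mul,
      Matrix.smul_mul, Matrix.trace_add, Matrix.trace_sum, Matrix.trace_smul, smul_eq_mul]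
    linarith
  have hw : w + ∑ k ∈ s, c k • a k = 0 := by
    generalize w + ∑ k ∈ s, c k • a k = b at hpos'
    by_contra hb
    have hbb : 0 < b ⬝ᵥ b := by
      simpa using Matrix.dotProduct_star_self_pos_iff.2 hb
    have := hpos' 1 (mem_posForm_of_posDef Matrix.PosDef.one)
      (-((((W + ∑ k ∈ s, c k • M k) * 1).trace + 1) / (b ⬝ᵥ b)) • b)
    rw [dotProduct_smul, smul_eq_mul, neg_mul, div_mul_cancel₀ _ hbb.ne'] at this
    linarith
  refine ⟨c, hc, posSemidef_of_forall_posForm ?_ fun G hG => ?_, hw⟩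
  · rw [Matrix.IsSymm, Matrix.transpose_add, Matrix.transpose_sum, hW.eq]
    simp only [Matrix.transpose_smul, (hM _).eq]
  · simpa [hw] using hpos' G hG 0

end PositiveMatrices

/-! ### Matrices acting on tuples of vectors -/

section KronId

variable {H : Type*} [NormedAddCommGroup H] [InnerProductSpace ℝ H]
variable {ι ι' κ κ' : Type*} [Fintype κ] [Fintype κ']

lemma kronId_mul (M : Matrix ι κ ℝ) (N : Matrix κ κ' ℝ) (z : κ' → H) :
    kronId (M * N) z = kronId M (kronId N z) := by
  ext i
  simp only [kronId, Matrix.mul_apply, Finset.sum_smul, Finset.smul_sum, smul_smul]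
  exact Finset.sum_comm

lemma kronId_one [DecidableEq κ] (z : κ → H) : kronId (1 : Matrix κ κ ℝ) z = z := by
  ext i
  simp [kronId, Matrix.one_apply]

lemma kronId_zero (z : κ → H) : kronId (0 : Matrix ι κ ℝ) z = 0 := by
  ext i
  simp [kronId]

lemma kronId_neg (M : Matrix ι κ ℝ) (z : κ → H) : kronId (-M) z = -kronId M z := by
  ext i
  simp [kronId]

lemma kronId_add (M N : Matrix ι κ ℝ) (z : κ → H) :
    kronId (M + N) z = kronId M z + kronId N z := by
  ext i
  simp [kronId, add_smul, Finset.sum_add_distrib]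

lemma kronId_sub (M N : Matrix ι κ ℝ) (z : κ → H) :
    kronId (M - N) z = kronId M z - kronId N z := by
  rw [sub_eq_add_neg, kronId_add, kronId_neg, sub_eq_add_neg]

lemma kronId_smul (c : ℝ) (M : Matrix ι κ ℝ) (z : κ → H) :
    kronId (c • M) z = c • kronId M z := by
  ext i
  simp [kronId, Finset.smul_sum, smul_smul]

lemma kronId_apply_add (M : Matrix ι κ ℝ) (z w : κ → H) :
    kronId M (z + w) = kronId M z + kronId M w := by
  ext i
  simp [kronId, Finset.sum_add_distrib]

lemma kronId_apply_sub (M : Matrix ι κ ℝ) (z w : κ → H) :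
    kronId M (z - w) = kronId M z - kronId M w := by
  ext i
  simp [kronId, smul_sub]

lemma kronId_fromCols (M : Matrix ι κ ℝ) (N : Matrix ι κ' ℝ) (z : κ → H) (w : κ' → H) :
    kronId (Matrix.fromCols M N) (Sum.elim z w) = kronId M z + kronId N w := by
  ext i
  simp [kronId]

lemma kronId_fromRows (M : Matrix ι κ ℝ) (N : Matrix ι' κ ℝ) (z : κ → H) :
    kronId (Matrix.fromRows M N) z = Sum.elim (kronId M z) (kronId N z) := by
  ext (i | i) <;> simp [kronId]

lemma kronId_diagUnit {m : ℕ} (l : Fin m) (z : Fin m → H) :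
    kronId (diagUnit l) z = Pi.single l (z l) := by
  ext i
  rcases eq_or_ne i l with rfl | h
  · simp [kronId, diagUnit, Matrix.diagonal_apply]
  · simp [kronId, diagUnit, Matrix.diagonal_apply, h]

lemma inner_kronId_apply (M : Matrix ι κ ℝ) (z : κ → H) (h : H) (i : ι) :
    inner ℝ h (kronId M z i) = M.mulVec (fun j => inner ℝ h (z j)) i := by
  simp [kronId, inner_sum, real_inner_smul_right, Matrix.mulVec, dotProduct]

/-- A kernel inclusion between real matrices carries over to tuples of vectors. -/
lemma kronId_eq_zero_of_ker_le {M : Matrix ι κ ℝ} {N : Matrix ι' κ ℝ}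
    (h : LinearMap.ker M.mulVecLin ≤ LinearMap.ker N.mulVecLin) {z : κ → H}
    (hz : kronId M z = 0) : kronId N z = 0 := by
  ext i
  refine ext_inner_left ℝ fun v => ?_
  have h1 : (fun j => inner ℝ v (z j)) ∈ LinearMap.ker M.mulVecLin := by
    rw [LinearMap.mem_ker, Matrix.mulVecLin_apply]
    ext i
    rw [← inner_kronId_apply, hz]
    simp
  have h2 := h h1
  rw [LinearMap.mem_ker, Matrix.mulVecLin_apply] at h2
  rw [inner_kronId_apply, h2]
  simp

lemma exists_mul_eq_of_range_le [DecidableEq κ'] {M : Matrix ι κ ℝ} {N : Matrix ι κ' ℝ}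
    (h : LinearMap.range N.mulVecLin ≤ LinearMap.range M.mulVecLin) :
    ∃ L : Matrix κ κ' ℝ, N = M * L := by
  have h1 : ∀ j, ∃ c, M.mulVec c = N.mulVec (Pi.single j 1) := fun j => h ⟨Pi.single j 1, rfl⟩
  choose c hc using h1
  refine ⟨Matrix.of fun i j => c j i, ?_⟩
  ext i j
  have := congrFun (hc j) i
  simp only [Matrix.mulVec_single_one, Matrix.col_apply] at this
  rw [← this]
  rfl

variable [Fintype ι]

lemma quadForm_eq_sum (M : Matrix ι ι ℝ) (z : ι → H) :
    quadForm M z = ∑ i, ∑ j, M i j * inner ℝ (z i) (z j) := by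
  simp [quadForm, kronId, inner_sum, real_inner_smul_right]

lemma quadForm_eq_trace (M : Matrix ι ι ℝ) (z : ι → H) :
    quadForm M z = (M * Matrix.gram ℝ z).trace := by
  rw [quadForm_eq_sum]
  simp only [Matrix.trace, Matrix.diag_apply, Matrix.mul_apply, Matrix.gram_apply]
  exact Finset.sum_congr rfl fun i _ => Finset.sum_congr rfl fun j _ => by
    rw [real_inner_comm]

lemma quadForm_add (M N : Matrix ι ι ℝ) (z : ι → H) :
    quadForm (M + N) z = quadForm M z + quadForm N z := by
  simp [quadForm, kronId_add, inner_add_right, Finset.sum_add_distrib]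

lemma quadForm_sub (M N : Matrix ι ι ℝ) (z : ι → H) :
    quadForm (M - N) z = quadForm M z - quadForm N z := by
  simp [quadForm, kronId_sub, inner_sub_right]

lemma quadForm_smul (c : ℝ) (M : Matrix ι ι ℝ) (z : ι → H) :
    quadForm (c • M) z = c * quadForm M z := by
  simp [quadForm, kronId_smul, real_inner_smul_right, Finset.mul_sum]

lemma quadForm_zero (z : ι → H) : quadForm (0 : Matrix ι ι ℝ) z = 0 := by
  simp [quadForm, kronId_zero]

lemma quadForm_sum {α : Type*} (s : Finset α) (M : α → Matrix ι ι ℝ) (z : ι → H) :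
    quadForm (∑ a ∈ s, M a) z = ∑ a ∈ s, quadForm (M a) z := by
  classical
  induction s using Finset.induction_on with
  | empty => simp [quadForm_zero]
  | insert a s ha ih => rw [Finset.sum_insert ha, Finset.sum_insert ha, quadForm_add, ih]

lemma quadForm_conj (X : Matrix ι κ ℝ) (M : Matrix ι ι ℝ) (z : κ → H) :
    quadForm (X.transpose * M * X) z = quadForm M (kronId X z) := by
  rw [quadForm, Matrix.mul_assoc]
  simp only [kronId_mul]
  simp only [quadForm]
  generalize hw : kronId M (kronId X z) = w
  simp only [kronId, inner_sum, sum_inner, real_inner_smul_left, real_inner_smul_right,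
    Matrix.transpose_apply]
  exact Finset.sum_comm

open scoped MatrixOrder in
lemma exists_eq_transpose_mul_self [DecidableEq ι] {M : Matrix ι ι ℝ} (hM : M.PosSemidef) :
    ∃ X : Matrix ι ι ℝ, M = X.transpose * X := by
  obtain ⟨X, hX⟩ := CStarAlgebra.nonneg_iff_eq_star_mul_self.1 hM.nonneg
  exact ⟨X, by rw [hX, Matrix.star_eq_conjTranspose, Matrix.conjTranspose_eq_transpose_of_trivial]⟩

lemma quadForm_nonneg {M : Matrix ι ι ℝ} (hM : M.PosSemidef) (z : ι → H) : 0 ≤ quadForm M z := by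
  classical
  obtain ⟨X, rfl⟩ := exists_eq_transpose_mul_self hM
  rw [← mul_one X.transpose, quadForm_conj, quadForm, kronId_one]
  exact Finset.sum_nonneg fun i _ => real_inner_self_nonneg

/-- Every positive semidefinite matrix is the Gram matrix of vectors in a space of sufficiently
large dimension. -/
lemma exists_gram_eq [DecidableEq ι] (hdim : (Fintype.card ι : Cardinal) ≤ Module.rank ℝ H)
    {G : Matrix ι ι ℝ} (hG : G.PosSemidef) : ∃ z : ι → H, G = Matrix.gram ℝ z := by
  obtain ⟨v, hv⟩ := Module.le_rank_iff.1 hdim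
  have he := InnerProductSpace.gramSchmidtNormed_orthonormal (𝕜 := ℝ) hv
  have he' := he.comp _ (Fintype.equivFin ι).injective
  obtain ⟨X, rfl⟩ := exists_eq_transpose_mul_self hG
  refine ⟨kronId X.transpose
    (InnerProductSpace.gramSchmidtNormed ℝ v ∘ Fintype.equivFin ι), ?_⟩
  ext i j
  rw [Matrix.gram_apply]
  simp only [kronId]
  rw [he'.inner_sum]
  simp [Matrix.mul_apply]

/-- The quadratic form of the interpolation matrix is the bound in the interpolation
inequality. -/
lemma quadForm_interpM {m : ℕ} {σ : Fin m → ℝ≥0} {β : Fin m → ℝ≥0∞} (l : Fin m)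
    (hσβ : (σ l : ℝ≥0∞) < β l) (d u v : Fin m → H) :
    quadForm (interpM σ β l) (Sum.elim d (Sum.elim u v))
      = interpGap (σ l) (β l) (d l) (u l) (v l) := by
  have hs : ∀ w : Fin m → H, ∀ c : ℝ, ∀ w' : H,
      ∑ i, inner ℝ (w i) ((c • Pi.single l w' : Fin m → H) i) = c * inner ℝ (w l) w' := by
    intro w c w'
    rw [Finset.sum_eq_single l]
    · simp [real_inner_smul_right]
    · intro i _ hi
      simp [hi]
    · simp
  have hs' : ∀ w : Fin m → H, ∀ w' : H,
      ∑ i, inner ℝ (w i) ((Pi.single l w' : Fin m → H) i) = inner ℝ (w l) w' := by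
    intro w w'
    simpa using hs w 1 w'
  rw [interpM, interpGap]
  split_ifs with hβ
  · rw [quadForm_smul, hβ, gapCoeff_top]
    simp only [quadForm, col3, row3, kronId_fromRows, kronId_fromCols, Fintype.sum_sum_type,
      Sum.elim_inl, Sum.elim_inr, kronId_smul, kronId_zero, kronId_diagUnit, Pi.add_apply,
      Pi.zero_apply, inner_add_right, Finset.sum_add_distrib, hs, hs', inner_zero_right,
      Finset.sum_const_zero, real_inner_self_eq_norm_sq]
    rw [real_inner_comm]
    ring
  · have hL := toReal_sub_pos hσβ hβ
    rw [quadForm_smul, gapCoeff_of_ne_top hσβ hβ]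
    simp only [quadForm, col3, row3, kronId_fromRows, kronId_fromCols, Fintype.sum_sum_type,
      Sum.elim_inl, Sum.elim_inr, kronId_smul, kronId_neg, kronId_diagUnit, Pi.add_apply,
      Pi.neg_apply, inner_add_right, inner_neg_right, Finset.sum_add_distrib,
      Finset.sum_neg_distrib, hs, hs', real_inner_self_eq_norm_sq]
    have h1 : ‖u l - v l - (σ l : ℝ) • d l‖ ^ 2
        = ‖u l‖ ^ 2 + ‖v l‖ ^ 2 + (σ l : ℝ) ^ 2 * ‖d l‖ ^ 2
        - 2 * inner ℝ (u l) (v l) - 2 * (σ l : ℝ) * inner ℝ (u l) (d l)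
        + 2 * (σ l : ℝ) * inner ℝ (v l) (d l) := by
      rw [norm_sub_sq_real, norm_sub_sq_real, inner_sub_left, real_inner_smul_right,
        real_inner_smul_right, norm_smul, Real.norm_of_nonneg (σ l).coe_nonneg]
      ring
    rw [h1, real_inner_comm (u l) (d l), real_inner_comm (v l) (d l), real_inner_comm (u l) (v l)]
    field_simp
    ring

end KronId

/-! ### Lifted coordinates of a current point, a successor and a fixed point -/

section Lift

variable {H : Type*} [NormedAddCommGroup H] [InnerProductSpace ℝ H] {n m : ℕ}

/-- The tuple `z = (x - x⋆, u, u₊, v)` consists of the lifted coordinates of a family of three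
points that satisfy all linear equations of the algorithm; here `u⋆ = N v`. Nothing is required
about subgradients and function values. -/
structure IsLift (K : StateSpace n m) (z : LiftIdx n m → H) (pt : Label → Point H n m) :
    Prop where
  coords : ∃ v, (pt .star).u = kronId (matN m) v ∧
    z = Sum.elim ((pt .cur).x - (pt .star).x) (Sum.elim (pt .cur).u (Sum.elim (pt .next).u v))
  output : ∀ i, (pt i).y = kronId K.C (pt i).x + kronId K.D (pt i).u
  next : (pt .next).x = kronId K.A (pt .cur).x + kronId K.B (pt .cur).u
  star : (pt .star).x = kronId K.A (pt .star).x + kronId K.B (pt .star).u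

/-- The differences of function values `(F - F⋆, F₊ - F⋆)`. -/
def valueDiff (pt : Label → Point H n m) : Fin m ⊕ Fin m → ℝ :=
  Sum.elim ((pt .cur).F - (pt .star).F) ((pt .next).F - (pt .star).F)

variable {K : StateSpace n m} {z : LiftIdx n m → H} {pt : Label → Point H n m}

lemma IsLift.kronId_matE (h : IsLift K z pt) {i j : Label} (hij : i ≠ j) :
    kronId (matE K i j) z
      = Sum.elim ((pt i).y - (pt j).y) (Sum.elim (pt i).u (pt j).u) := by
  obtain ⟨⟨v, hv, rfl⟩, hy, hn, hs⟩ := h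
  have hs' : kronId K.C (kronId K.A (pt .star).x)
      = kronId K.C (pt .star).x - kronId K.C (kronId K.B (pt .star).u) := by
    rw [eq_sub_iff_add_eq, ← kronId_apply_add, ← hs]
  rw [hy i, hy j]
  cases i <;> cases j <;> first
    | exact absurd rfl hij
    | (simp only [matE, col3, row4, kronId_fromRows, kronId_fromCols, kronId_zero, kronId_one,
        kronId_neg, kronId_add, kronId_sub, kronId_mul, kronId_apply_add, kronId_apply_sub,
        hn, hs', ← hv, zero_add, add_zero, sub_zero]
       try congr 1
       try abel)

lemma IsLift.quadForm_liftM (h : IsLift K z pt) {σ : Fin m → ℝ≥0} {β : Fin m → ℝ≥0∞} {l : Fin m}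
    (hσβ : (σ l : ℝ≥0∞) < β l) {i j : Label} (hij : i ≠ j) :
    quadForm (liftM K σ β l i j) z
      = interpGap (σ l) (β l) ((pt i).y l - (pt j).y l) ((pt i).u l) ((pt j).u l) := by
  rw [liftM, quadForm_conj, h.kronId_matE hij, quadForm_interpM l hσβ, Pi.sub_apply]

lemma liftA_dotProduct {E : Type*} (pt : Label → Point E n m) (l : Fin m) {i j : Label} (hij : i ≠ j) :
    liftA l i j ⬝ᵥ valueDiff pt = -((pt i).F l - (pt j).F l) := by
  rw [liftA, Matrix.mulVec_transpose, ← Matrix.dotProduct_mulVec, interpA, neg_dotProduct,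
    single_dotProduct, one_mul]
  congr 1
  cases i <;> cases j <;> first
    | exact absurd rfl hij
    | (simp [matH, valueDiff, Matrix.neg_mulVec])

lemma IsLift.kronId_sigmaCur (h : IsLift K z pt) :
    kronId (sigmaCur n m) z
      = Sum.elim ((pt .cur).x - (pt .star).x) (Sum.elim (pt .cur).u (pt .star).u) := by
  obtain ⟨⟨v, hv, rfl⟩, -, -, -⟩ := h
  simp only [sigmaCur, col3, row4, kronId_fromRows, kronId_fromCols, kronId_zero, kronId_one,
    zero_add, add_zero, hv]

lemma IsLift.kronId_sigmaNext (h : IsLift K z pt) :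
    kronId (sigmaNext K) z
      = Sum.elim ((pt .next).x - (pt .star).x) (Sum.elim (pt .next).u (pt .star).u) := by
  obtain ⟨⟨v, hv, rfl⟩, -, hn, hs⟩ := h
  rw [hn]
  simp only [sigmaNext, col3, row4, kronId_fromRows, kronId_fromCols, kronId_zero, kronId_one,
    kronId_neg, kronId_mul, kronId_apply_sub, ← hv, zero_add, add_zero, sub_zero]
  congr 1
  conv_rhs => rw [hs]
  abel

lemma IsLift.objective_cur (h : IsLift K z pt)
    (Q P : Matrix (StateIdx n m) (StateIdx n m) ℝ) (q p : Fin m → ℝ) :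
    quadForm ((sigmaCur n m).transpose * (Q - P) * sigmaCur n m) z
        + Sum.elim (q - p) 0 ⬝ᵥ valueDiff pt
      = quadAnsatz Q q (pt .cur) (pt .star) - quadAnsatz P p (pt .cur) (pt .star) := by
  rw [quadForm_conj, h.kronId_sigmaCur, quadForm_sub, valueDiff, sumElim_dotProduct_sumElim,
    zero_dotProduct, sub_dotProduct, quadAnsatz, quadAnsatz]
  ring

lemma IsLift.objective_next (h : IsLift K z pt)
    (Q S : Matrix (StateIdx n m) (StateIdx n m) ℝ) (q s : Fin m → ℝ) (ρ : ℝ) :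
    quadForm ((sigmaCur n m).transpose * (ρ • Q - S) * sigmaCur n m
        - (sigmaNext K).transpose * Q * sigmaNext K) z
        + Sum.elim (ρ • q - s) (-q) ⬝ᵥ valueDiff pt
      = ρ * quadAnsatz Q q (pt .cur) (pt .star) - quadAnsatz S s (pt .cur) (pt .star)
        - quadAnsatz Q q (pt .next) (pt .star) := by
  rw [quadForm_sub, quadForm_conj, quadForm_conj, h.kronId_sigmaCur, h.kronId_sigmaNext,
    quadForm_sub, quadForm_smul, valueDiff, sumElim_dotProduct_sumElim, neg_dotProduct,
    sub_dotProduct, smul_dotProduct, quadAnsatz, quadAnsatz, quadAnsatz, smul_eq_mul]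
  ring

/-- A vector whose components sum to `0` is in the range of `N`. -/
lemma exists_eq_kronId_matN (hm : 1 ≤ m) {u : Fin m → H} (hu : ∑ i, u i = 0) :
    ∃ v, u = kronId (matN m) v := by
  obtain ⟨k, rfl⟩ : ∃ k, m = k + 1 := ⟨m - 1, by omega⟩
  refine ⟨fun j => u (Fin.castSucc j), ?_⟩
  rw [Fin.sum_univ_castSucc] at hu
  ext i
  change u i = ∑ j : Fin k, (if i.val = j.val then (1 : ℝ) else if i.val = k then -1 else 0) •
    u (Fin.castSucc j)
  refine Fin.lastCases ?_ (fun i => ?_) i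
  · have h1 : ∀ j : Fin k, (Fin.last k).val ≠ j.val := fun j => by simpa using j.2.ne'
    simp only [if_neg (h1 _)]
    simp [eq_neg_of_add_eq_zero_right hu]
  · simp only [Fin.val_castSucc, if_neg i.2.ne, Fin.val_inj]
    simp

lemma IsFixedPoint.sum_u_eq_zero (hfix : FixedPointEncoding K) {f : Fin m → H → EReal}
    {ξ : Point H n m} (h : IsFixedPoint K f ξ) : ∑ i, ξ.u i = 0 := by
  have h1 := kronId_eq_zero_of_ker_le hfix.null_le (z := Sum.elim ξ.x ξ.u) (by
    rw [kronId_fromCols, kronId_sub, kronId_one, kronId_neg]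
    conv_lhs => enter [1, 1]; rw [h.state]
    abel)
  simpa [kronId] using congrFun h1 (Sum.inr ())

/-- The family of three points with the given members. -/
def threePoints (ξ ξp ξs : Point H n m) : Label → Point H n m
  | .cur => ξ
  | .next => ξp
  | .star => ξs

lemma exists_isLift (hm : 1 ≤ m) (hfix : FixedPointEncoding K) {f : Fin m → H → EReal}
    {ξ ξp ξs : Point H n m} (hξ : IsConsistent K f ξ)
    (hξp : ξp.y = kronId K.C ξp.x + kronId K.D ξp.u)
    (hnext : ξp.x = kronId K.A ξ.x + kronId K.B ξ.u) (hξs : IsFixedPoint K f ξs) :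
    ∃ z, IsLift K z (threePoints ξ ξp ξs) := by
  obtain ⟨v, hv⟩ := exists_eq_kronId_matN hm (hξs.sum_u_eq_zero hfix)
  refine ⟨_, ⟨v, hv, rfl⟩, fun i => ?_, hnext, hξs.state⟩
  cases i
  exacts [hξ.output, hξp, hξs.consistent.output]

/-- A point with the state of a successor and zero subgradients, which need not be consistent:
it completes the lifted coordinates where only a point and a fixed point are given. -/
def formalSuccessor (K : StateSpace n m) (ξ : Point H n m) : Point H n m where
  x := kronId K.A ξ.x + kronId K.B ξ.u
  u := 0
  y := kronId K.C (kronId K.A ξ.x + kronId K.B ξ.u) + kronId K.D 0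
  F := 0

/-- The range condition provides a fixed point for every choice of lifted coordinates. -/
lemma exists_points_of_lift (hfix : FixedPointEncoding K) (z : LiftIdx n m → H)
    (χ : Fin m ⊕ Fin m → ℝ) : ∃ pt, IsLift K z pt ∧ valueDiff pt = χ := by
  obtain ⟨d, z, rfl⟩ : ∃ d z', z = Sum.elim d z' := ⟨_, _, (Sum.elim_comp_inl_inr z).symm⟩
  obtain ⟨u, z, rfl⟩ : ∃ d z', z = Sum.elim d z' := ⟨_, _, (Sum.elim_comp_inl_inr z).symm⟩
  obtain ⟨up, v, rfl⟩ : ∃ d z', z = Sum.elim d z' := ⟨_, _, (Sum.elim_comp_inl_inr z).symm⟩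
  obtain ⟨F, Fp, rfl⟩ : ∃ F F', χ = Sum.elim F F' := ⟨_, _, (Sum.elim_comp_inl_inr χ).symm⟩
  obtain ⟨L, hL⟩ := exists_mul_eq_of_range_le hfix.range_le
  -- The fixed point with zero output, that is, the image under `L` of `(v, 0)`.
  obtain ⟨xs, hxs⟩ : ∃ xs : Fin n → H, xs = kronId K.A xs + kronId K.B (kronId (matN m) v) := by
    refine ⟨kronId L (Sum.elim v 0), ?_⟩
    have h1 := congrArg (fun M => kronId M (Sum.elim v (0 : Unit → H)) ∘ Sum.inl) hL
    simp only [kronId_mul _ L, kronId_fromRows, ← Matrix.fromRows_fromCols_eq_fromBlocks,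
      kronId_fromCols, kronId_zero, add_zero, Sum.elim_comp_inl, kronId_sub, kronId_one] at h1
    rw [← kronId_mul K.B, h1]
    abel
  let x := xs + d
  let us := kronId (matN m) v
  let xp := kronId K.A x + kronId K.B u
  refine ⟨threePoints ⟨x, u, kronId K.C x + kronId K.D u, F⟩
    ⟨xp, up, kronId K.C xp + kronId K.D up, Fp⟩ ⟨xs, us, kronId K.C xs + kronId K.D us, 0⟩,
    ⟨⟨v, rfl, ?_⟩, fun i => ?_, rfl, hxs⟩, ?_⟩
  · simp [threePoints, x]
  · cases i <;> rfl
  · simp [threePoints, valueDiff]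

/-- Nonpositivity of a constraint of the semidefinite program is an interpolation inequality. -/
lemma IsLift.constraint_le_zero_iff (h : IsLift K z pt) {σ : Fin m → ℝ≥0} {β : Fin m → ℝ≥0∞}
    {l : Fin m} (hσβ : (σ l : ℝ≥0∞) < β l) {i j : Label} (hij : i ≠ j) :
    liftA l i j ⬝ᵥ valueDiff pt + quadForm (liftM K σ β l i j) z ≤ 0 ↔
      interpGap (σ l) (β l) ((pt i).y l - (pt j).y l) ((pt i).u l) ((pt j).u l)
        ≤ (pt i).F l - (pt j).F l := by
  rw [liftA_dotProduct pt l hij, h.quadForm_liftM hσβ hij, neg_add_nonpos_iff]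

variable [CompleteSpace H]

lemma IsLift.constraint_le_zero (h : IsLift K z pt) {σ : Fin m → ℝ≥0} {β : Fin m → ℝ≥0∞}
    (hσβ : ∀ l, (σ l : ℝ≥0∞) < β l) {f : Fin m → H → EReal} (hf : f ∈ ProductClass σ β)
    {i j : Label} (hi : IsConsistent K f (pt i)) (hj : IsConsistent K f (pt j)) (hij : i ≠ j)
    (l : Fin m) :
    liftA l i j ⬝ᵥ valueDiff pt + quadForm (liftM K σ β l i j) z ≤ 0 :=
  (h.constraint_le_zero_iff (hσβ l) hij).2 <|
    interpGap_le (hσβ l) (hf l) (hi.value l) (hj.value l) (hi.subgradient l) (hj.subgradient l)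

/-- If the constraints hold for all pairs of labels in `I`, then the points with labels in `I`
are consistent for a common tuple of functions of the class. -/
lemma IsLift.exists_isConsistent (h : IsLift K z pt) {σ : Fin m → ℝ≥0} {β : Fin m → ℝ≥0∞}
    (hσβ : ∀ l, (σ l : ℝ≥0∞) < β l) {I : Finset Label} (hI : I.Nonempty)
    (hc : ∀ l, ∀ i ∈ I, ∀ j ∈ I, i ≠ j →
      liftA l i j ⬝ᵥ valueDiff pt + quadForm (liftM K σ β l i j) z ≤ 0) :
    ∃ f ∈ ProductClass (H := H) σ β, ∀ i ∈ I, IsConsistent K f (pt i) := by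
  have : Nonempty I := hI.to_subtype
  have hl : ∀ l, ∃ f ∈ FunClass (σ l) (β l), ∀ i : I, (pt i).u l ∈ subdiff f ((pt i).y l) ∧
      ((pt i).F l : EReal) = f ((pt i).y l) := fun l =>
    exists_mem_funClass (hσβ l) (fun i : I => (pt i).y l) (fun i => (pt i).u l)
      (fun i => (pt i).F l) fun i j hij =>
        (h.constraint_le_zero_iff (hσβ l) (Subtype.coe_ne_coe.2 hij)).1
          (hc l i i.2 j j.2 (Subtype.coe_ne_coe.2 hij))
  choose f hf hfi using hl
  exact ⟨f, hf, fun i hi => ⟨h.output i, fun l => (hfi l ⟨i, hi⟩).1, fun l => (hfi l ⟨i, hi⟩).2⟩⟩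

end Lift

/-! ### Certificates -/

section Certificates

variable {H : Type*} [NormedAddCommGroup H] [InnerProductSpace ℝ H] {n m : ℕ}
  {K : StateSpace n m} {σ : Fin m → ℝ≥0} {β : Fin m → ℝ≥0∞} {I : Finset Label}
  {W : Matrix (LiftIdx n m) (LiftIdx n m) ℝ} {w : Fin m ⊕ Fin m → ℝ}

/-- Weak duality. -/
lemma Certificate.objective_nonneg {lam : Fin m → Label → Label → ℝ}
    (h : Certificate K σ β I W w lam) {z : LiftIdx n m → H} {χ : Fin m ⊕ Fin m → ℝ}
    (hc : ∀ l, ∀ i ∈ I, ∀ j ∈ I, i ≠ j →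
      liftA l i j ⬝ᵥ χ + quadForm (liftM K σ β l i j) z ≤ 0) :
    0 ≤ quadForm W z + w ⬝ᵥ χ := by
  have h1 := quadForm_nonneg h.posSemidef z
  have h2 := congrArg (· ⬝ᵥ χ) h.eq_zero
  simp only [add_dotProduct, sum_dotProduct, smul_dotProduct, zero_dotProduct,
    smul_eq_mul] at h2
  simp only [quadForm_add, quadForm_sum, quadForm_smul] at h1
  have h3 : ∑ l, ∑ ij ∈ I.offDiag, lam l ij.1 ij.2 * (liftA l ij.1 ij.2 ⬝ᵥ χ)
      + ∑ l, ∑ ij ∈ I.offDiag, lam l ij.1 ij.2 * quadForm (liftM K σ β l ij.1 ij.2) z ≤ 0 := by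
    simp only [← Finset.sum_add_distrib, ← mul_add]
    refine Finset.sum_nonpos fun l _ => Finset.sum_nonpos fun ij hij => ?_
    obtain ⟨hi, hj, hne⟩ := Finset.mem_offDiag.1 hij
    exact mul_nonpos_of_nonneg_of_nonpos (h.nonneg l _ hi _ hj hne) (hc l _ hi _ hj hne)
  linarith

lemma isSymm_conj {ι κ : Type*} [Fintype ι] {M : Matrix ι ι ℝ} (hM : M.IsSymm)
    (X : Matrix ι κ ℝ) : (X.transpose * M * X).IsSymm := by
  rw [Matrix.IsSymm, Matrix.transpose_mul, Matrix.transpose_mul, Matrix.transpose_transpose,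
    hM.eq, Matrix.mul_assoc]

lemma isSymm_interpM (l : Fin m) : (interpM σ β l).IsSymm := by
  have hd : (diagUnit l).transpose = diagUnit l := Matrix.diagonal_transpose _
  have h : ∀ i j, diagUnit l i j = diagUnit l j i := fun i j => congrFun (congrFun hd j) i
  refine Matrix.IsSymm.ext fun i j => ?_
  rw [interpM]
  split_ifs <;> rcases i with i | i | i <;> rcases j with j | j | j <;>
    simp [col3, row3, h i j]

lemma isSymm_liftM (l : Fin m) (i j : Label) : (liftM K σ β l i j).IsSymm :=
  isSymm_conj (isSymm_interpM l) _

/-- Strong duality: under the Slater condition, an inequality between quadratic functions of the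
lifted coordinates that follows from the constraints has a certificate. -/
lemma exists_certificate (hm : 1 ≤ m) (hdim : ((n + 3 * m - 1 : ℕ) : Cardinal) ≤ Module.rank ℝ H)
    (hslater : SlaterPoint K σ β) (hW : W.IsSymm)
    (h : ∀ (z : LiftIdx n m → H) (χ : Fin m ⊕ Fin m → ℝ),
      (∀ l, ∀ i ∈ I, ∀ j ∈ I, i ≠ j →
        liftA l i j ⬝ᵥ χ + quadForm (liftM K σ β l i j) z ≤ 0) →
      0 ≤ quadForm W z + w ⬝ᵥ χ) :
    ∃ lam, Certificate K σ β I W w lam := by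
  have hcard : Fintype.card (LiftIdx n m) = n + 3 * m - 1 := by
    simp only [Fintype.card_sum, Fintype.card_fin]
    omega
  rw [← hcard] at hdim
  obtain ⟨G₀, χ₀, hG₀, h₀⟩ := hslater
  obtain ⟨c, hc, hpsd, hzero⟩ := exists_sdp_multipliers
    ((Finset.univ : Finset (Fin m)) ×ˢ I.offDiag)
    (M := fun k => liftM K σ β k.1 k.2.1 k.2.2) (fun k => isSymm_liftM _ _ _)
    (fun k => liftA k.1 k.2.1 k.2.2) hW w (by
      intro G χ hG hk
      obtain ⟨z, rfl⟩ := exists_gram_eq hdim hG.posSemidef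
      rw [← quadForm_eq_trace, add_comm]
      refine h z χ fun l i hi j hj hij => ?_
      rw [quadForm_eq_trace]
      exact hk (l, i, j) (by simp [hi, hj, hij]))
    hG₀ (χ₀ := χ₀) (fun k hk => h₀ _ _ _ (Finset.mem_offDiag.1 (Finset.mem_product.1 hk).2).2.2)
  rw [Finset.sum_product] at hpsd hzero
  exact ⟨fun l i j => c (l, i, j), fun l i hi j hj hij => hc (l, i, j) (by simp [hi, hj, hij]),
    hpsd, hzero⟩

end Certificates

/-! ### The semidefinite program and quadratic Lyapunov inequalities -/

section Equivalence

variable {H : Type*} [NormedAddCommGroup H] [InnerProductSpace ℝ H] [CompleteSpace H] {n m : ℕ}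
  {K : StateSpace n m} {σ : Fin m → ℝ≥0} {β : Fin m → ℝ≥0∞}

lemma isSymm_objective_cur {Q P : Matrix (StateIdx n m) (StateIdx n m) ℝ} (hQ : Q.IsSymm)
    (hP : P.IsSymm) : ((sigmaCur n m).transpose * (Q - P) * sigmaCur n m).IsSymm :=
  isSymm_conj (hQ.sub hP) _

lemma Certificate.quadAnsatz_le (hm : 1 ≤ m) (hσβ : ∀ l, (σ l : ℝ≥0∞) < β l)
    (hfix : FixedPointEncoding K) {Q P : Matrix (StateIdx n m) (StateIdx n m) ℝ}
    {q p : Fin m → ℝ} {lam : Fin m → Label → Label → ℝ}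
    (h : Certificate K σ β {.cur, .star}
      ((sigmaCur n m).transpose * (Q - P) * sigmaCur n m) (Sum.elim (q - p) 0) lam)
    {f : Fin m → H → EReal} (hf : f ∈ ProductClass σ β) {ξ ξs : Point H n m}
    (hξ : IsConsistent K f ξ) (hξs : IsFixedPoint K f ξs) :
    quadAnsatz P p ξ ξs ≤ quadAnsatz Q q ξ ξs := by
  obtain ⟨z, hz⟩ := exists_isLift (ξp := formalSuccessor K ξ) hm hfix hξ rfl rfl hξs
  have hcons : ∀ i ∈ ({.cur, .star} : Finset Label),
      IsConsistent K f (threePoints ξ (formalSuccessor K ξ) ξs i) := by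
    intro i hi
    rcases i with _ | _ | _
    exacts [hξ, absurd hi (by decide), hξs.consistent]
  have h1 := h.objective_nonneg fun l i hi j hj hij =>
    hz.constraint_le_zero hσβ hf (hcons i hi) (hcons j hj) hij l
  rw [hz.objective_cur] at h1
  exact sub_nonneg.1 h1

lemma Certificate.quadAnsatz_decrease (hm : 1 ≤ m) (hσβ : ∀ l, (σ l : ℝ≥0∞) < β l)
    (hfix : FixedPointEncoding K) {Q S : Matrix (StateIdx n m) (StateIdx n m) ℝ}
    {q s : Fin m → ℝ} {ρ : ℝ} {lam : Fin m → Label → Label → ℝ}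
    (h : Certificate K σ β {.cur, .next, .star}
      ((sigmaCur n m).transpose * (ρ • Q - S) * sigmaCur n m
        - (sigmaNext K).transpose * Q * sigmaNext K) (Sum.elim (ρ • q - s) (-q)) lam)
    {f : Fin m → H → EReal} (hf : f ∈ ProductClass σ β) {ξ ξp ξs : Point H n m}
    (hξ : IsConsistent K f ξ) (hξp : IsSuccessor K f ξ ξp) (hξs : IsFixedPoint K f ξs) :
    quadAnsatz Q q ξp ξs ≤ ρ * quadAnsatz Q q ξ ξs - quadAnsatz S s ξ ξs := by
  obtain ⟨z, hz⟩ := exists_isLift hm hfix hξ hξp.consistent.output hξp.state hξs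
  have hcons : ∀ i, IsConsistent K f (threePoints ξ ξp ξs i) := by
    rintro (_ | _ | _)
    exacts [hξ, hξp.consistent, hξs.consistent]
  have h1 := h.objective_nonneg fun l i _ j _ hij =>
    hz.constraint_le_zero hσβ hf (hcons i) (hcons j) hij l
  rw [hz.objective_next] at h1
  exact sub_nonneg.1 h1

lemma exists_certificate_of_quadAnsatz_le (hm : 1 ≤ m) (hσβ : ∀ l, (σ l : ℝ≥0∞) < β l)
    (hfix : FixedPointEncoding K) (hdim : ((n + 3 * m - 1 : ℕ) : Cardinal) ≤ Module.rank ℝ H)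
    (hslater : SlaterPoint K σ β) {Q P : Matrix (StateIdx n m) (StateIdx n m) ℝ}
    (hQ : Q.IsSymm) (hP : P.IsSymm) {q p : Fin m → ℝ}
    (h : ∀ f ∈ ProductClass (H := H) σ β, ∀ ξ ξs : Point H n m,
      IsConsistent K f ξ → IsFixedPoint K f ξs → quadAnsatz P p ξ ξs ≤ quadAnsatz Q q ξ ξs) :
    ∃ lam, Certificate K σ β {.cur, .star}
      ((sigmaCur n m).transpose * (Q - P) * sigmaCur n m) (Sum.elim (q - p) 0) lam := by
  refine exists_certificate (H := H) hm hdim hslater (isSymm_objective_cur hQ hP) ?_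
  intro z χ hc
  obtain ⟨pt, hz, rfl⟩ := exists_points_of_lift hfix z χ
  obtain ⟨f, hf, hcons⟩ := hz.exists_isConsistent hσβ ⟨.cur, by simp⟩ hc
  rw [hz.objective_cur]
  exact sub_nonneg.2 (h f hf _ _ (hcons .cur (by simp)) ⟨hz.star, hcons .star (by simp)⟩)

lemma exists_certificate_of_quadAnsatz_decrease (hm : 1 ≤ m) (hσβ : ∀ l, (σ l : ℝ≥0∞) < β l)
    (hfix : FixedPointEncoding K) (hdim : ((n + 3 * m - 1 : ℕ) : Cardinal) ≤ Module.rank ℝ H)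
    (hslater : SlaterPoint K σ β) {Q S : Matrix (StateIdx n m) (StateIdx n m) ℝ}
    (hQ : Q.IsSymm) (hS : S.IsSymm) {q s : Fin m → ℝ} {ρ : ℝ}
    (h : ∀ f ∈ ProductClass (H := H) σ β, ∀ ξ ξp ξs : Point H n m,
      IsConsistent K f ξ → IsSuccessor K f ξ ξp → IsFixedPoint K f ξs →
        quadAnsatz Q q ξp ξs ≤ ρ * quadAnsatz Q q ξ ξs - quadAnsatz S s ξ ξs) :
    ∃ lam, Certificate K σ β {.cur, .next, .star}
      ((sigmaCur n m).transpose * (ρ • Q - S) * sigmaCur n m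
        - (sigmaNext K).transpose * Q * sigmaNext K) (Sum.elim (ρ • q - s) (-q)) lam := by
  refine exists_certificate (H := H) hm hdim hslater
    ((isSymm_objective_cur (hQ.smul ρ) hS).sub (isSymm_conj hQ _)) ?_
  intro z χ hc
  obtain ⟨pt, hz, rfl⟩ := exists_points_of_lift hfix z χ
  obtain ⟨f, hf, hcons⟩ := hz.exists_isConsistent hσβ ⟨.cur, by simp⟩ hc
  rw [hz.objective_next]
  exact sub_nonneg.2 (h f hf _ _ _ (hcons .cur (by simp)) ⟨hz.next, hcons .next (by simp)⟩
    ⟨hz.star, hcons .star (by simp)⟩)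

end Equivalence

end LyapunovAnalysis

theorem theorem1 {H : Type*} [NormedAddCommGroup H] [InnerProductSpace ℝ H] [CompleteSpace H]
    (n m : ℕ) (hm : 1 ≤ m)
    (σ : Fin m → ℝ≥0) (β : Fin m → ℝ≥0∞) (hσβ : ∀ i, (σ i : ℝ≥0∞) < β i)
    (K : StateSpace n m) (hfix : FixedPointEncoding K) (hwell : WellPosed K β)
    (ρ : ℝ) (hρ : ρ ∈ Set.Icc (0 : ℝ) 1)
    (P T : Matrix (StateIdx n m) (StateIdx n m) ℝ) (hP : P.IsSymm) (hT : T.IsSymm)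
    (p t : Fin m → ℝ)
    (hPp : NonnegLowerBound H K σ β P p) (hTt : NonnegLowerBound H K σ β T t) :
    (SDPFeasible K σ β P p T t ρ →
      ∃ V R : Point H n m → Point H n m → ℝ, IsQuadratic V ∧ IsQuadratic R ∧
        QuadraticLyapunovInequality K σ β P p T t ρ V R) ∧
    (((n + 3 * m - 1 : ℕ) : Cardinal) ≤ Module.rank ℝ H → SlaterPoint K σ β →
      (∃ V R : Point H n m → Point H n m → ℝ, IsQuadratic V ∧ IsQuadratic R ∧
        QuadraticLyapunovInequality K σ β P p T t ρ V R) →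
      SDPFeasible K σ β P p T t ρ) := by
  constructor
  · rintro ⟨Q, S, q, s, lam₁, lam₂, lam₃, hQ, hS, h₁, h₂, h₃⟩
    exact ⟨quadAnsatz Q q, quadAnsatz S s, ⟨Q, q, hQ, fun _ _ => rfl⟩, ⟨S, s, hS, fun _ _ => rfl⟩,
      fun f hf ξ ξp ξs hξ hξp hξs => h₁.quadAnsatz_decrease hm hσβ hfix hf hξ hξp hξs,
      fun f hf ξ ξs hξ hξs => ⟨h₂.quadAnsatz_le hm hσβ hfix hf hξ hξs, hPp f hf ξ ξs hξ hξs⟩,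
      fun f hf ξ ξs hξ hξs => ⟨h₃.quadAnsatz_le hm hσβ hfix hf hξ hξs, hTt f hf ξ ξs hξ hξs⟩⟩
  · rintro hdim hslater ⟨V, R, ⟨Q, q, hQ, hV⟩, ⟨S, s, hS, hR⟩, hVR⟩
    obtain rfl : V = quadAnsatz Q q := funext₂ hV
    obtain rfl : R = quadAnsatz S s := funext₂ hR
    obtain ⟨lam₁, h₁⟩ := exists_certificate_of_quadAnsatz_decrease hm hσβ hfix hdim hslater hQ hS
      hVR.C1
    obtain ⟨lam₂, h₂⟩ := exists_certificate_of_quadAnsatz_le hm hσβ hfix hdim hslater hQ hP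
      fun f hf ξ ξs hξ hξs => (hVR.C2 f hf ξ ξs hξ hξs).1
    obtain ⟨lam₃, h₃⟩ := exists_certificate_of_quadAnsatz_le hm hσβ hfix hdim hslater hS hT
      fun f hf ξ ξs hξ hξs => (hVR.C3 f hf ξ ξs hξ hξs).1
    exact ⟨Q, S, q, s, lam₁, lam₂, lam₃, hQ, hS, h₁, h₂, h₃⟩
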